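/- Let $\mathcal A$ be a finite alphabet, $\sigma$ the shift map on $\mathcal A^{\mathbb Z}$. A \emph{quasigroup SFT with a 1-block operation} is a nonempty shift of finite type $\Lambda\subseteq\mathcal A^{\mathbb Z}$ (every symbol of $\mathcal A$ being used) with a left and right cancellable operation $*$ on $\Lambda$ of the form $(x*y)_i=x_i\bullet y_i$, where $\bullet:\mathcal A\times\mathcal A\to\mathcal A$. It is a \emph{Markov shift} if $\Lambda$ is the set of all sequences that follow some transition matrix on $\mathcal A$. An \emph{isomorphism} of two such objects is a homeomorphism which commutes with the shift maps and is a homomorphism for the operations. For $a\in\mathcal A$ let $F(a)$ (resp. $P(a)$) be the set of symbols $b$ such that $ab$ (resp. $ba$) occurs in $\Lambda$. For $H\subseteq\mathcal A$ let $\mathcal A/H=\{g\bullet H: g\in\mathcal A\}$. Call $H$ \emph{compatible} if $\mathcal A/H$ is a partition of $\mathcal A$ and the setwise product of two elements of $\mathcal A/H$ is again in $\mathcal A/H$. The \emph{elementary isomorphisms} lead from $\Lambda$ to the following shifts, which are considered up to the names of their symbols. (1) \emph{State splitting by successors}: for a compatible $H\subseteq F(a)$, $a\in\mathcal A$, the alphabet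 is $\{(g,C): g\in\mathcal A,\ C\in\mathcal A/H,\ C\subseteq F(g)\}$ with the coordinatewise operation, and the transitions are $(g,C)\to(g',C')$ iff $g'\in C$. (2) \emph{State splitting by predecessors}: for a compatible $H\subseteq P(a)$, the alphabet is $\{(g,C): C\in\mathcal A/H,\ C\subseteq P(g)\}$ with the coordinatewise operation, and the transitions are $(g,C)\to(g',C')$ iff $g\in C'$. (3) \emph{Amalgamation by common predecessors and disjoint successors}: for a compatible $H\subseteq F(a)$ such that $H\cap P(b)$ has at most one element for every $b\in\mathcal A$, the alphabet is $\mathcal A/H$ with the setwise operation, and the transitions are $C\to C'$ iff $C'\subseteq F(h)$ for some $h\in C$. (4) \emph{Amalgamation by common successors and disjoint predecessors}: for a compatible $H\subseteq P(a)$ such that $H\cap F(b)$ has at most one element for every $b\in\mathcal A$, the alphabet is $\mathcal A/H$ with the setwise operation, and the transitions are $C\to C'$ iff $C\subseteq P(h)$ for some $h\in C'$. If $\Lambda$ is a Markov shift, the new shift consists of all sequences that follow the given transitions. If $\Lambda$ is an arbitrary SFT, one requires in addition, in (1) and (2), that the sequence of first coordinates is a point of $\Lambda$, and in (3) and (4),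 that the sequence is the sequence of cosets $(C_i)$ of a point $x\in\Lambda$, $x_i\in C_i$ (for Markov shifts these requirements hold automatically). \textbf{Theorem.} Let $\Lambda$ and $\Lambda'$ be two quasigroup SFTs with 1-block operations. (a) $\Lambda$ and $\Lambda'$ are isomorphic if and only if one can pass from $\Lambda$ to $\Lambda'$ by a finite sequence of elementary isomorphisms and inverses of elementary isomorphisms between quasigroup SFTs with 1-block operations. (b) If $\Lambda$ and $\Lambda'$ are Markov shifts, they are isomorphic if and only if one can pass from $\Lambda$ to $\Lambda'$ by a finite sequence of elementary isomorphisms (without inverses), all between Markov shifts. -/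

import Mathlib

open Set SymbolicDynamics.FullShift

universe u

/-- The set `F(x[-n,0])` of symbols that can follow, in a point of `Λ`, the block of `x` at the
coordinates `-n, …, 0`. -/
def blockFollowers {A : Type u} (Λ : Set (ℤ → A)) (x : ℤ → A) (n : ℕ) : Set A :=
  {b | ∃ y ∈ Λ, (∀ j : ℤ, -(n : ℤ) ≤ j → j ≤ 0 → y j = x j) ∧ y 1 = b}

/-- Shifts of finite type: there is `N` such that for every `x ∈ Λ` and every `n ≥ N` one has
`F(x[-n,0]) = F(x[-N,0])`. -/
def IsSFT {A : Type u} (Λ : Set (ℤ → A)) : Prop :=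
  ∃ N : ℕ, ∀ x ∈ Λ, ∀ n : ℕ, N ≤ n → blockFollowers Λ x n = blockFollowers Λ x N

/-- A quasigroup SFT with a 1-block operation: a nonempty two-sided shift of finite type on a
finite (discrete) alphabet all of whose symbols are used, with a 1-block operation
`(x * y)_i = op (x_i) (y_i)` under which it is closed and which is left and right cancellable on
the points of the shift. -/
structure QuasigroupSFT where
  Alph : Type u
  [top : TopologicalSpace Alph]
  [disc : DiscreteTopology Alph]
  [fin : Finite Alph]
  shift : Subshift Alph ℤ
  nonempty : shift.carrier.Nonempty
  used : ∀ a : Alph, ∃ x ∈ shift.carrier, ∃ i : ℤ, x i = a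
  isSFT : IsSFT shift.carrier
  op : Alph → Alph → Alph
  op_mem : ∀ x ∈ shift.carrier, ∀ y ∈ shift.carrier, (fun i => op (x i) (y i)) ∈ shift.carrier
  left_cancel : ∀ x ∈ shift.carrier, ∀ y ∈ shift.carrier, ∀ z ∈ shift.carrier,
    (fun i => op (x i) (y i)) = (fun i => op (x i) (z i)) → y = z
  right_cancel : ∀ x ∈ shift.carrier, ∀ y ∈ shift.carrier, ∀ z ∈ shift.carrier,
    (fun i => op (y i) (x i)) = (fun i => op (z i) (x i)) → y = z

namespace QuasigroupSFT

attribute [instance] QuasigroupSFT.top QuasigroupSFT.disc QuasigroupSFT.fin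

/-- The space of points of the shift, with the topology induced by the product topology. -/
abbrev Points (X : QuasigroupSFT.{u}) : Type u := X.shift.carrier

/-- The quasigroup operation on the points of the shift. -/
def mul (X : QuasigroupSFT.{u}) (x y : X.Points) : X.Points :=
  ⟨fun i => X.op (x.1 i) (y.1 i), X.op_mem x.1 x.2 y.1 y.2⟩

/-- The shift map `(σ x)_i = x_{i+1}` on the points of the shift. -/
def sigma (X : QuasigroupSFT.{u}) (x : X.Points) : X.Points :=
  ⟨SymbolicDynamics.FullShift.shift (1 : ℤ) x.1, X.shift.mapsTo 1 x.2⟩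

/-- Isomorphism: a homeomorphism of the point spaces that commutes with the shift maps and is a
homomorphism for the quasigroup operations. -/
def Isomorphic (X Y : QuasigroupSFT.{u}) : Prop :=
  ∃ ζ : X.Points ≃ₜ Y.Points,
    (∀ x, ζ (X.sigma x) = Y.sigma (ζ x)) ∧ ∀ x y, ζ (X.mul x y) = Y.mul (ζ x) (ζ y)

/-- Markov shifts: the points are exactly the sequences that follow a transition matrix. -/
def IsMarkov (X : QuasigroupSFT.{u}) : Prop :=
  ∃ T : X.Alph → X.Alph → Prop, X.shift.carrier = {x | ∀ i : ℤ, T (x i) (x (i + 1))}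

/-- The follower set `F(a)` of a symbol. -/
def foll (X : QuasigroupSFT.{u}) (a : X.Alph) : Set X.Alph :=
  {b | ∃ x ∈ X.shift.carrier, ∃ i : ℤ, x i = a ∧ x (i + 1) = b}

/-- The predecessor set `P(a)` of a symbol. -/
def pred (X : QuasigroupSFT.{u}) (a : X.Alph) : Set X.Alph :=
  {b | ∃ x ∈ X.shift.carrier, ∃ i : ℤ, x i = b ∧ x (i + 1) = a}

/-- The product `S • T = {s • t}` of two sets of symbols. -/
def setMul (X : QuasigroupSFT.{u}) (S T : Set X.Alph) : Set X.Alph := Set.image2 X.op S T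

/-- The family `{g • H : g}` of cosets of a set `H` of symbols. -/
def cosets (X : QuasigroupSFT.{u}) (H : Set X.Alph) : Set (Set X.Alph) :=
  Set.range fun g => X.op g '' H

/-- The cosets of `H` form a partition of the alphabet that is compatible with the operation. -/
def Compatible (X : QuasigroupSFT.{u}) (H : Set X.Alph) : Prop :=
  Setoid.IsPartition (X.cosets H) ∧
    ∀ S ∈ X.cosets H, ∀ T ∈ X.cosets H, X.setMul S T ∈ X.cosets H

/-- `Y` is, up to the names of its symbols, the shift with alphabet `B`, set of points `S` and
symbol operation `m` (given as a relation: `m b c d` says that `d` is the product of `b`, `c`). -/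
def IsCopyOf (Y : QuasigroupSFT.{u}) {B : Type u} (S : Set (ℤ → B)) (m : B → B → B → Prop) :
    Prop :=
  ∃ e : Y.Alph ≃ B,
    (∀ y : ℤ → Y.Alph, y ∈ Y.shift.carrier ↔ (fun i => e (y i)) ∈ S) ∧
    ∀ b c, m (e b) (e c) (e (Y.op b c))

/-- The alphabet of the splitting by successors: pairs `(g, C)`, `C` a coset of `H` contained in
`F(g)`. -/
abbrev SplitFollAlph (X : QuasigroupSFT.{u}) (H : Set X.Alph) : Type u :=
  {p : X.Alph × Set X.Alph // p.2 ∈ X.cosets H ∧ p.2 ⊆ X.foll p.1}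

/-- The points of the splitting by successors: the transitions are `(g, C) → (g', C')` iff
`g' ∈ C`, and the sequence of first coordinates has to be a point of `X`. The last requirement is
automatic when `X` is a Markov shift, see `mem_splitFollShift_iff`. -/
def splitFollShift (X : QuasigroupSFT.{u}) (H : Set X.Alph) : Set (ℤ → X.SplitFollAlph H) :=
  {y | (∀ i : ℤ, (y (i + 1)).1.1 ∈ (y i).1.2) ∧ (fun i => (y i).1.1) ∈ X.shift.carrier}

/-- `Y` is obtained from `X` by a state splitting by successors. -/
def SplitByFoll (X Y : QuasigroupSFT.{u}) : Prop :=
  ∃ (a : X.Alph) (H : Set X.Alph), H ⊆ X.foll a ∧ X.Compatible H ∧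
    Y.IsCopyOf (X.splitFollShift H) fun p q r =>
      r.1.1 = X.op p.1.1 q.1.1 ∧ r.1.2 = X.setMul p.1.2 q.1.2

/-- The alphabet of the splitting by predecessors. -/
abbrev SplitPredAlph (X : QuasigroupSFT.{u}) (H : Set X.Alph) : Type u :=
  {p : X.Alph × Set X.Alph // p.2 ∈ X.cosets H ∧ p.2 ⊆ X.pred p.1}

/-- The points of the splitting by predecessors: the transitions are `(g, C) → (g', C')` iff
`g ∈ C'`, and the sequence of first coordinates has to be a point of `X` (automatic when `X` is a
Markov shift, see `mem_splitPredShift_iff`). -/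
def splitPredShift (X : QuasigroupSFT.{u}) (H : Set X.Alph) : Set (ℤ → X.SplitPredAlph H) :=
  {y | (∀ i : ℤ, (y i).1.1 ∈ (y (i + 1)).1.2) ∧ (fun i => (y i).1.1) ∈ X.shift.carrier}

/-- `Y` is obtained from `X` by a state splitting by predecessors. -/
def SplitByPred (X Y : QuasigroupSFT.{u}) : Prop :=
  ∃ (a : X.Alph) (H : Set X.Alph), H ⊆ X.pred a ∧ X.Compatible H ∧
    Y.IsCopyOf (X.splitPredShift H) fun p q r =>
      r.1.1 = X.op p.1.1 q.1.1 ∧ r.1.2 = X.setMul p.1.2 q.1.2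

/-- The points of the amalgamation by common predecessors and disjoint successors: the transitions
are `C → C'` iff `C' ⊆ F(h)` for some `h ∈ C`, and the sequence has to be the sequence of cosets
of a point of `X` (automatic when `X` is a Markov shift, see `mem_amalgFollShift_iff`). -/
def amalgFollShift (X : QuasigroupSFT.{u}) (H : Set X.Alph) : Set (ℤ → X.cosets H) :=
  {y | (∀ i : ℤ, ∃ h ∈ (y i).1, (y (i + 1)).1 ⊆ X.foll h) ∧
    ∃ x ∈ X.shift.carrier, ∀ i, x i ∈ (y i).1}

/-- `Y` is obtained from `X` by an amalgamation by common predecessors and disjoint successors. -/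
def AmalgDisjointFoll (X Y : QuasigroupSFT.{u}) : Prop :=
  ∃ (a : X.Alph) (H : Set X.Alph), H ⊆ X.foll a ∧ X.Compatible H ∧
    (∀ b : X.Alph, (H ∩ X.pred b).Subsingleton) ∧
    Y.IsCopyOf (X.amalgFollShift H) fun C D E => E.1 = X.setMul C.1 D.1

/-- The points of the amalgamation by common successors and disjoint predecessors: the transitions
are `C → C'` iff `C ⊆ P(h)` for some `h ∈ C'`, and the sequence has to be the sequence of cosets
of a point of `X` (automatic when `X` is a Markov shift, see `mem_amalgPredShift_iff`). -/
def amalgPredShift (X : QuasigroupSFT.{u}) (H : Set X.Alph) : Set (ℤ → X.cosets H) :=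
  {y | (∀ i : ℤ, ∃ h ∈ (y (i + 1)).1, (y i).1 ⊆ X.pred h) ∧
    ∃ x ∈ X.shift.carrier, ∀ i, x i ∈ (y i).1}

/-- `Y` is obtained from `X` by an amalgamation by common successors and disjoint predecessors. -/
def AmalgDisjointPred (X Y : QuasigroupSFT.{u}) : Prop :=
  ∃ (a : X.Alph) (H : Set X.Alph), H ⊆ X.pred a ∧ X.Compatible H ∧
    (∀ b : X.Alph, (H ∩ X.foll b).Subsingleton) ∧
    Y.IsCopyOf (X.amalgPredShift H) fun C D E => E.1 = X.setMul C.1 D.1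

/-- `Y` is obtained from `X` by one of the four elementary isomorphisms. -/
def Elementary (X Y : QuasigroupSFT.{u}) : Prop :=
  X.SplitByFoll Y ∨ X.SplitByPred Y ∨ X.AmalgDisjointFoll Y ∨ X.AmalgDisjointPred Y

theorem IsMarkov.mem_iff {X : QuasigroupSFT.{u}} (hX : X.IsMarkov) (x : ℤ → X.Alph) :
    x ∈ X.shift.carrier ↔ ∀ i : ℤ, x (i + 1) ∈ X.foll (x i) := by
  refine ⟨fun hx i => ⟨x, hx, i, rfl, rfl⟩, fun h => ?_⟩
  obtain ⟨T, hT⟩ := hX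
  rw [hT]
  intro i
  obtain ⟨z, hz, k, h1, h2⟩ := h i
  rw [hT] at hz
  have := hz k
  rwa [h1, h2] at this

theorem mem_splitFollShift_iff {X : QuasigroupSFT.{u}} (hX : X.IsMarkov) (H : Set X.Alph)
    (y : ℤ → X.SplitFollAlph H) :
    y ∈ X.splitFollShift H ↔ ∀ i : ℤ, (y (i + 1)).1.1 ∈ (y i).1.2 :=
  ⟨fun h => h.1, fun h => ⟨h, (hX.mem_iff _).2 fun i => (y i).2.2 (h i)⟩⟩

theorem mem_splitPredShift_iff {X : QuasigroupSFT.{u}} (hX : X.IsMarkov) (H : Set X.Alph)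
    (y : ℤ → X.SplitPredAlph H) :
    y ∈ X.splitPredShift H ↔ ∀ i : ℤ, (y i).1.1 ∈ (y (i + 1)).1.2 :=
  ⟨fun h => h.1, fun h => ⟨h, (hX.mem_iff _).2 fun i => (y (i + 1)).2.2 (h i)⟩⟩

theorem mem_amalgFollShift_iff {X : QuasigroupSFT.{u}} (hX : X.IsMarkov) (H : Set X.Alph)
    (y : ℤ → X.cosets H) :
    y ∈ X.amalgFollShift H ↔ ∀ i : ℤ, ∃ h ∈ (y i).1, (y (i + 1)).1 ⊆ X.foll h := by
  refine ⟨fun h => h.1, fun h => ⟨h, ?_⟩⟩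
  choose x hx hx' using h
  exact ⟨x, (hX.mem_iff _).2 fun i => hx' i (hx (i + 1)), hx⟩

theorem mem_amalgPredShift_iff {X : QuasigroupSFT.{u}} (hX : X.IsMarkov) (H : Set X.Alph)
    (y : ℤ → X.cosets H) :
    y ∈ X.amalgPredShift H ↔ ∀ i : ℤ, ∃ h ∈ (y (i + 1)).1, (y i).1 ⊆ X.pred h := by
  refine ⟨fun h => h.1, fun h => ⟨h, ?_⟩⟩
  have h' : ∀ i : ℤ, ∃ g ∈ (y i).1, (y (i - 1)).1 ⊆ X.pred g := fun i => by
    simpa using h (i - 1)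
  choose x hx hx' using h'
  refine ⟨x, (hX.mem_iff _).2 fun i => ?_, hx⟩
  have := hx' (i + 1)
  rw [add_sub_cancel_right] at this
  exact this (hx i)

end QuasigroupSFT

/-! Each elementary isomorphism really induces an isomorphism. After a splitting, the added coset is
forced by the neighbouring symbol. In an amalgamation, the symbol is recovered from its coset and
the neighbouring coset. This gives the "if" directions.

Conversely, let `ζ` be an isomorphism. By compactness, `ζ` and its inverse have finite coding
windows. Splitting `X` into long blocks makes `ζ` a 1-block map (`exists_split_blocks`). Now split
the source according to the image of the next (or previous) symbol, and the target into 2-blocks.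
The induced map is still 1-block, and the window of its inverse is shorter by one coordinate
(`exists_splits_of_window`). When the window is a single coordinate, the map renames symbols, which
is an amalgamation along a one-point set. So `X` and `Y` have iterated splittings that agree up to
names (`Isomorphic.exists_splits`), which proves (a). For Markov shifts every splitting is undone by
an amalgamation (`SplitByFoll.amalg`), so the return path to `Y` needs no inverses, which proves
(b).

The algebra behind this: the transitions `(a, b)`, `b ∈ F(a)`, are closed under the operation and
both divisions. Hence follower sets that meet have equal predecessor data (`pred_eq_of_mem`), and
congruence classes inside a follower set give the required compatible `H`. Finite type costs
nothing, since cancellation implies it (`isSFT_of_cancellable`). -/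

/-! ### Division and finite type from cancellation -/

section CancellableBlockOperation

variable {A : Type u} [Finite A] {Λ : Set (ℤ → A)} {op : A → A → A}

/-- In a closed-under-`op` set of sequences with left cancellation, left division is possible. -/
theorem exists_left_div (hop : ∀ x ∈ Λ, ∀ y ∈ Λ, (fun i => op (x i) (y i)) ∈ Λ)
    (hcancel : ∀ x ∈ Λ, ∀ y ∈ Λ, ∀ z ∈ Λ,
      (fun i => op (x i) (y i)) = (fun i => op (x i) (z i)) → y = z)
    {x y : ℤ → A} (hx : x ∈ Λ) (hy : y ∈ Λ) : ∃ z ∈ Λ, (fun i => op (x i) (z i)) = y := by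
  -- There are finitely many families `a ↦ (op a)^[n]`, so one pair of exponents serves all symbols.
  -- The injective translation by `x` is therefore periodic, hence onto.
  obtain ⟨i, j, hij, h⟩ := Finite.exists_ne_map_eq_of_infinite fun n : ℕ => fun a : A => (op a)^[n]
  wlog hlt : i < j generalizing i j
  · exact this j i hij.symm h.symm (by omega)
  let T : Λ → Λ := fun z => ⟨fun k => op (x k) (z.1 k), hop x hx z.1 z.2⟩
  have hT : Function.Injective T := fun z w hzw =>
    Subtype.ext (hcancel x hx z.1 z.2 w.1 w.2 (congrArg Subtype.val hzw))
  have hiter : ∀ (n : ℕ) (z : Λ) (k : ℤ), (T^[n] z).1 k = (op (x k))^[n] (z.1 k) := by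
    intro n
    induction n with
    | zero => intro z k; rfl
    | succ n ih => intro z k; rw [Function.iterate_succ_apply, ih, Function.iterate_succ_apply]
  have hid : T^[j - i] ⟨y, hy⟩ = ⟨y, hy⟩ := by
    apply hT.iterate i
    rw [← Function.iterate_add_apply, show i + (j - i) = j by omega]
    ext k
    rw [hiter, hiter]
    exact (congrFun (congrFun h (x k)) (y k)).symm
  obtain ⟨n, hn⟩ : ∃ n, j - i = n + 1 := ⟨j - i - 1, by omega⟩
  rw [hn, Function.iterate_succ_apply'] at hid
  exact ⟨(T^[n] ⟨y, hy⟩).1, (T^[n] ⟨y, hy⟩).2, congrArg Subtype.val hid⟩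

/-- Placing both symbols at coordinate 0 and dividing points gives surjectivity; finiteness of the
alphabet does the rest. -/
theorem op_left_bijective (hused : ∀ a : A, ∃ x ∈ Λ, x 0 = a)
    (hop : ∀ x ∈ Λ, ∀ y ∈ Λ, (fun i => op (x i) (y i)) ∈ Λ)
    (hcancel : ∀ x ∈ Λ, ∀ y ∈ Λ, ∀ z ∈ Λ,
      (fun i => op (x i) (y i)) = (fun i => op (x i) (z i)) → y = z) (a : A) :
    Function.Bijective (op a) := by
  refine Finite.surjective_iff_bijective.1 fun b => ?_
  obtain ⟨x, hx, rfl⟩ := hused a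
  obtain ⟨y, hy, rfl⟩ := hused b
  obtain ⟨z, -, hz⟩ := exists_left_div hop hcancel hx hy
  exact ⟨z 0, congrFun hz 0⟩

/-- Closed-under-`op` sets of sequences with a cancellable 1-block operation are of finite type:
all follower sets of blocks of a given length have the same cardinality. -/
theorem isSFT_of_cancellable (hused : ∀ a : A, ∃ x ∈ Λ, x 0 = a)
    (hop : ∀ x ∈ Λ, ∀ y ∈ Λ, (fun i => op (x i) (y i)) ∈ Λ)
    (hleft : ∀ x ∈ Λ, ∀ y ∈ Λ, ∀ z ∈ Λ,
      (fun i => op (x i) (y i)) = (fun i => op (x i) (z i)) → y = z)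
    (hright : ∀ x ∈ Λ, ∀ y ∈ Λ, ∀ z ∈ Λ,
      (fun i => op (y i) (x i)) = (fun i => op (z i) (x i)) → y = z) : IsSFT Λ := by
  -- Choose `z` with `x * z = x'`: multiplication by `z` carries continuations of a block of `x`
  -- injectively to continuations of the corresponding block of `x'`.
  have hle : ∀ x ∈ Λ, ∀ x' ∈ Λ, ∀ n,
      (blockFollowers Λ x n).ncard ≤ (blockFollowers Λ x' n).ncard := by
    intro x hx x' hx' n
    obtain ⟨z, hz, hxz⟩ := exists_left_div hop hleft hx hx'
    have hinj : Function.Injective fun b => op b (z 1) :=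
      (op_left_bijective (op := flip op) hused (fun x hx y hy => hop y hy x hx) hright (z 1)).1
    refine Set.ncard_le_ncard_of_injOn (fun b => op b (z 1)) ?_ hinj.injOn (Set.toFinite _)
    rintro b ⟨y, hy, hyx, rfl⟩
    refine ⟨fun i => op (y i) (z i), hop y hy z hz, fun j hj hj' => ?_, rfl⟩
    rw [← hxz]
    simp only [hyx j hj hj']
  rcases Λ.eq_empty_or_nonempty with rfl | ⟨x₀, hx₀⟩
  · exact ⟨0, fun x hx => hx.elim⟩
  -- Follower sets shrink as the block grows, and their size depends only on `n`; beyond the minimum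
  -- size they cannot shrink.
  refine ⟨Function.argmin fun n => (blockFollowers Λ x₀ n).ncard, fun x hx n hn => ?_⟩
  refine Set.eq_of_subset_of_ncard_le ?_ ?_ (Set.toFinite _)
  · rintro b ⟨y, hy, hyx, hb⟩
    exact ⟨y, hy, fun j hj hj' => hyx j (by omega) hj', hb⟩
  · exact (hle x hx x₀ hx₀ _).trans ((Function.argmin_le
      (fun n => (blockFollowers Λ x₀ n).ncard) n).trans (hle x₀ hx₀ x hx n))

end CancellableBlockOperation

/-! ### Symbol divisions and follower sets -/

namespace QuasigroupSFT

/-- The `k`-th power of the shift map. -/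
def shiftBy (X : QuasigroupSFT.{u}) (k : ℤ) (x : X.Points) : X.Points :=
  ⟨SymbolicDynamics.FullShift.shift k x.1, X.shift.mapsTo k x.2⟩

@[simp] theorem shiftBy_apply (X : QuasigroupSFT.{u}) (k : ℤ) (x : X.Points) (i : ℤ) :
    (X.shiftBy k x).1 i = x.1 (k + i) := rfl

@[simp] theorem sigma_apply (X : QuasigroupSFT.{u}) (x : X.Points) (i : ℤ) :
    (X.sigma x).1 i = x.1 (1 + i) := rfl

@[simp] theorem mul_apply (X : QuasigroupSFT.{u}) (x y : X.Points) (i : ℤ) :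
    (X.mul x y).1 i = X.op (x.1 i) (y.1 i) := rfl

theorem Points.ext {X : QuasigroupSFT.{u}} {x y : X.Points} (h : ∀ i, x.1 i = y.1 i) : x = y :=
  Subtype.ext (funext h)

theorem continuous_eval (X : QuasigroupSFT.{u}) (i : ℤ) : Continuous fun x : X.Points => x.1 i :=
  (continuous_apply i).comp continuous_subtype_val

theorem used_at (X : QuasigroupSFT.{u}) (a : X.Alph) (k : ℤ) : ∃ x : X.Points, x.1 k = a := by
  obtain ⟨x, hx, i, rfl⟩ := X.used a
  exact ⟨X.shiftBy (i - k) ⟨x, hx⟩, by simp⟩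

theorem used_zero (X : QuasigroupSFT.{u}) (a : X.Alph) : ∃ x ∈ X.shift.carrier, x 0 = a :=
  let ⟨x, hx⟩ := X.used_at a 0
  ⟨x.1, x.2, hx⟩

theorem op_bijective (X : QuasigroupSFT.{u}) (a : X.Alph) : Function.Bijective (X.op a) :=
  op_left_bijective X.used_zero X.op_mem X.left_cancel a

theorem op_bijective_right (X : QuasigroupSFT.{u}) (a : X.Alph) :
    Function.Bijective fun b => X.op b a :=
  op_left_bijective (op := flip X.op) X.used_zero (fun x hx y hy => X.op_mem y hy x hx)
    X.right_cancel a

/-- Left division of symbols. -/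
noncomputable def ld (X : QuasigroupSFT.{u}) (a b : X.Alph) : X.Alph :=
  (Equiv.ofBijective _ (X.op_bijective a)).symm b

/-- Right division of symbols. -/
noncomputable def rd (X : QuasigroupSFT.{u}) (b a : X.Alph) : X.Alph :=
  (Equiv.ofBijective _ (X.op_bijective_right a)).symm b

@[simp] theorem op_ld (X : QuasigroupSFT.{u}) (a b : X.Alph) : X.op a (X.ld a b) = b :=
  (Equiv.ofBijective _ (X.op_bijective a)).apply_symm_apply b

@[simp] theorem ld_op (X : QuasigroupSFT.{u}) (a b : X.Alph) : X.ld a (X.op a b) = b :=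
  (Equiv.ofBijective _ (X.op_bijective a)).symm_apply_apply b

@[simp] theorem rd_op (X : QuasigroupSFT.{u}) (b a : X.Alph) : X.op (X.rd b a) a = b :=
  (Equiv.ofBijective _ (X.op_bijective_right a)).apply_symm_apply b

@[simp] theorem op_rd (X : QuasigroupSFT.{u}) (b a : X.Alph) : X.rd (X.op b a) a = b :=
  (Equiv.ofBijective _ (X.op_bijective_right a)).symm_apply_apply b

theorem ld_mem (X : QuasigroupSFT.{u}) {x y : ℤ → X.Alph} (hx : x ∈ X.shift.carrier)
    (hy : y ∈ X.shift.carrier) : (fun i => X.ld (x i) (y i)) ∈ X.shift.carrier := by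
  obtain ⟨z, hz, rfl⟩ := exists_left_div X.op_mem X.left_cancel hx hy
  simpa using hz

theorem rd_mem (X : QuasigroupSFT.{u}) {x y : ℤ → X.Alph} (hx : x ∈ X.shift.carrier)
    (hy : y ∈ X.shift.carrier) : (fun i => X.rd (y i) (x i)) ∈ X.shift.carrier := by
  obtain ⟨z, hz, rfl⟩ := exists_left_div (op := flip X.op)
    (fun x hx y hy => X.op_mem y hy x hx) X.right_cancel hx hy
  simpa [flip] using hz

theorem mem_foll_iff (X : QuasigroupSFT.{u}) {a b : X.Alph} (k : ℤ) :
    b ∈ X.foll a ↔ ∃ x : X.Points, x.1 k = a ∧ x.1 (k + 1) = b := by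
  constructor
  · rintro ⟨x, hx, i, rfl, rfl⟩
    exact ⟨X.shiftBy (i - k) ⟨x, hx⟩, by simp, by simp [← add_assoc]⟩
  · rintro ⟨x, h⟩
    exact ⟨x.1, x.2, k, h⟩

theorem mem_pred_iff (X : QuasigroupSFT.{u}) {a b : X.Alph} : b ∈ X.pred a ↔ a ∈ X.foll b :=
  Iff.rfl

theorem succ_mem_foll (X : QuasigroupSFT.{u}) (x : X.Points) (i : ℤ) :
    x.1 (i + 1) ∈ X.foll (x.1 i) := ⟨x.1, x.2, i, rfl, rfl⟩

theorem foll_nonempty (X : QuasigroupSFT.{u}) (a : X.Alph) : (X.foll a).Nonempty := by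
  obtain ⟨x, rfl⟩ := X.used_at a 0
  exact ⟨_, X.succ_mem_foll x 0⟩

theorem exists_mem_foll (X : QuasigroupSFT.{u}) (b : X.Alph) : ∃ a, b ∈ X.foll a := by
  obtain ⟨x, hx⟩ := X.used_at b (0 + 1)
  exact ⟨_, hx ▸ X.succ_mem_foll x 0⟩

/-- With the two analogues for division below, this makes the set of transitions a subquasigroup of
the pairs of symbols. -/
theorem op_mem_foll (X : QuasigroupSFT.{u}) {a b c d : X.Alph} (h : b ∈ X.foll a)
    (h' : d ∈ X.foll c) : X.op b d ∈ X.foll (X.op a c) := by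
  obtain ⟨x, rfl, rfl⟩ := (X.mem_foll_iff 0).1 h
  obtain ⟨y, rfl, rfl⟩ := (X.mem_foll_iff 0).1 h'
  exact (X.mem_foll_iff 0).2 ⟨X.mul x y, rfl, rfl⟩

theorem ld_mem_foll (X : QuasigroupSFT.{u}) {a b c d : X.Alph} (h : b ∈ X.foll a)
    (h' : d ∈ X.foll c) : X.ld b d ∈ X.foll (X.ld a c) := by
  obtain ⟨x, rfl, rfl⟩ := (X.mem_foll_iff 0).1 h
  obtain ⟨y, rfl, rfl⟩ := (X.mem_foll_iff 0).1 h'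
  exact (X.mem_foll_iff 0).2 ⟨⟨_, X.ld_mem x.2 y.2⟩, rfl, rfl⟩

theorem rd_mem_foll (X : QuasigroupSFT.{u}) {a b c d : X.Alph} (h : b ∈ X.foll a)
    (h' : d ∈ X.foll c) : X.rd d b ∈ X.foll (X.rd c a) := by
  obtain ⟨x, rfl, rfl⟩ := (X.mem_foll_iff 0).1 h
  obtain ⟨y, rfl, rfl⟩ := (X.mem_foll_iff 0).1 h'
  exact (X.mem_foll_iff 0).2 ⟨⟨_, X.rd_mem x.2 y.2⟩, rfl, rfl⟩

/-- Symbols with a common predecessor have the same predecessors. -/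
theorem pred_eq_of_mem (X : QuasigroupSFT.{u}) {g b c : X.Alph} (hb : b ∈ X.foll g)
    (hc : c ∈ X.foll g) : X.pred b = X.pred c := by
  -- Apply the Mal'cev term `(x / (y \ y)) (y \ z)` to transitions: on the predecessors `g', g, g`
  -- it returns `g'`, on the successors `b, b, c` it returns `c`.
  have key : ∀ b c g', b ∈ X.foll g → c ∈ X.foll g → b ∈ X.foll g' → c ∈ X.foll g' := by
    intro b c g' hb hc h
    have hrd : ∀ b, X.rd b (X.ld b b) = b := fun b => by
      nth_rewrite 1 [← X.op_ld b b]
      exact X.op_rd _ _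
    simpa [hrd] using X.op_mem_foll (X.rd_mem_foll (X.ld_mem_foll hb hb) h) (X.ld_mem_foll hb hc)
  exact Set.ext fun g' => ⟨key b c g' hb hc, key c b g' hc hb⟩

/-! ### Compatible sets and congruences -/

section Cosets

variable {X : QuasigroupSFT.{u}} {H : Set X.Alph}

/-- The coset that contains a given symbol. -/
noncomputable def Compatible.coset (hH : X.Compatible H) (b : X.Alph) : Set X.Alph :=
  (hH.1.2 b).choose

theorem Compatible.coset_mem (hH : X.Compatible H) (b : X.Alph) : hH.coset b ∈ X.cosets H :=
  (hH.1.2 b).choose_spec.1.1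

theorem Compatible.mem_coset (hH : X.Compatible H) (b : X.Alph) : b ∈ hH.coset b :=
  (hH.1.2 b).choose_spec.1.2

theorem Compatible.coset_eq (hH : X.Compatible H) {b : X.Alph} {C : Set X.Alph}
    (hC : C ∈ X.cosets H) (hb : b ∈ C) : hH.coset b = C :=
  ((hH.1.2 b).choose_spec.2 C ⟨hC, hb⟩).symm

theorem Compatible.nonempty_of_mem (hH : X.Compatible H) {C : Set X.Alph}
    (hC : C ∈ X.cosets H) : C.Nonempty :=
  Setoid.nonempty_of_mem_partition hH.1 hC

theorem Compatible.coset_op (hH : X.Compatible H) (b c : X.Alph) :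
    hH.coset (X.op b c) = X.setMul (hH.coset b) (hH.coset c) :=
  hH.coset_eq (hH.2 _ (hH.coset_mem b) _ (hH.coset_mem c))
    (Set.mem_image2_of_mem (hH.mem_coset b) (hH.mem_coset c))

/-- If a set is contained in a follower set, its cosets that meet a follower set are contained in
it. -/
theorem coset_subset_foll_of_mem {a : X.Alph} (ha : H ⊆ X.foll a)
    {C : Set X.Alph} (hC : C ∈ X.cosets H) {b g : X.Alph} (hb : b ∈ C) (hbg : b ∈ X.foll g) :
    C ⊆ X.foll g := by
  obtain ⟨q, rfl⟩ := hC
  obtain ⟨h, hh, rfl⟩ := hb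
  -- Dividing `q • h ∈ F(g)` by `h ∈ F(a)` places `q` in `F(g / a)`; multiplying back by any element
  -- of `H` lands in `F(g)`.
  have hq : q ∈ X.foll (X.rd g a) := by simpa using X.rd_mem_foll (ha hh) hbg
  rintro _ ⟨h', hh', rfl⟩
  simpa using X.op_mem_foll hq (ha hh')

theorem Compatible.coset_subset_foll (hH : X.Compatible H) {a : X.Alph} (ha : H ⊆ X.foll a)
    {b g : X.Alph} (hbg : b ∈ X.foll g) : hH.coset b ⊆ X.foll g :=
  coset_subset_foll_of_mem ha (hH.coset_mem b) (hH.mem_coset b) hbg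

/-- The classes of a quasigroup congruence are the cosets of any of them. -/
theorem cosets_eq_classes (r : Setoid X.Alph)
    (hop : ∀ a b c d, r a b → r c d → r (X.op a c) (X.op b d))
    (hld : ∀ a b c d, r a b → r c d → r (X.ld a c) (X.ld b d)) (b₀ : X.Alph) :
    X.cosets {b | r b b₀} = r.classes := by
  have key : ∀ g, X.op g '' {b | r b b₀} = {b | r b (X.op g b₀)} := by
    intro g
    ext b
    constructor
    · rintro ⟨c, hc, rfl⟩
      exact hop _ _ _ _ (r.refl g) hc
    · intro hb
      refine ⟨X.ld g b, ?_, by simp⟩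
      simpa using hld _ _ _ _ (r.refl g) hb
  ext C
  constructor
  · rintro ⟨g, rfl⟩
    exact ⟨_, key g⟩
  · rintro ⟨y, rfl⟩
    exact ⟨X.rd y b₀, by simp [key]⟩

/-- The source of every compatible set constructed below. Compatibility with left division makes a
product of classes fill a whole class. -/
theorem compatible_of_congruence (r : Setoid X.Alph)
    (hop : ∀ a b c d, r a b → r c d → r (X.op a c) (X.op b d))
    (hld : ∀ a b c d, r a b → r c d → r (X.ld a c) (X.ld b d)) (b₀ : X.Alph) :
    X.Compatible {b | r b b₀} := by
  rw [Compatible, cosets_eq_classes r hop hld]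
  refine ⟨Setoid.isPartition_classes r, ?_⟩
  rintro _ ⟨a, rfl⟩ _ ⟨b, rfl⟩
  refine ⟨X.op a b, Set.Subset.antisymm ?_ ?_⟩
  · rintro _ ⟨c, hc, d, hd, rfl⟩
    exact hop _ _ _ _ hc hd
  · intro c hc
    exact ⟨a, r.refl a, X.ld a c, by simpa using hld _ _ _ _ (r.refl a) hc, by simp⟩

end Cosets

/-! ### Isomorphisms and coding windows -/

section Isomorphisms

variable {X Y Z : QuasigroupSFT.{u}}

/-- The homeomorphism commutes with the shift maps and is a homomorphism. -/
def IsIso (ζ : X.Points ≃ₜ Y.Points) : Prop :=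
  (∀ x, ζ (X.sigma x) = Y.sigma (ζ x)) ∧ ∀ x y, ζ (X.mul x y) = Y.mul (ζ x) (ζ y)

theorem IsIso.refl (X : QuasigroupSFT.{u}) : IsIso (Homeomorph.refl X.Points) :=
  ⟨fun _ => rfl, fun _ _ => rfl⟩

theorem IsIso.symm {ζ : X.Points ≃ₜ Y.Points} (h : IsIso ζ) : IsIso ζ.symm := by
  constructor
  · intro y
    rw [Homeomorph.symm_apply_eq, h.1, ζ.apply_symm_apply]
  · intro x y
    rw [Homeomorph.symm_apply_eq, h.2, ζ.apply_symm_apply, ζ.apply_symm_apply]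

theorem IsIso.trans {ζ : X.Points ≃ₜ Y.Points} {η : Y.Points ≃ₜ Z.Points} (h : IsIso ζ)
    (h' : IsIso η) : IsIso (ζ.trans η) :=
  ⟨fun x => by simp [h.1, h'.1], fun x y => by simp [h.2, h'.2]⟩

theorem IsIso.shiftBy {ζ : X.Points ≃ₜ Y.Points} (h : IsIso ζ) (k : ℤ) (x : X.Points) :
    ζ (X.shiftBy k x) = Y.shiftBy k (ζ x) := by
  have hs : ∀ (V : QuasigroupSFT.{u}) (k : ℤ) (v : V.Points),
      V.sigma (V.shiftBy k v) = V.shiftBy (k + 1) v := fun V k v =>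
    Points.ext fun i => by simp [add_assoc]
  have hinj : Function.Injective Y.sigma := fun y y' hy => Points.ext fun i => by
    simpa using congrFun (congrArg Subtype.val hy) (i - 1)
  induction k with
  | zero =>
    have : ∀ (V : QuasigroupSFT.{u}) (v : V.Points), V.shiftBy 0 v = v := fun V v =>
      Points.ext fun i => by simp
    rw [this, this]
  | succ k ih => rw [← hs, h.1, ih, hs]
  | pred k ih =>
    apply hinj
    rw [← h.1, hs, hs, sub_add_cancel, ih]

theorem IsIso.apply_eq {ζ : X.Points ≃ₜ Y.Points} (h : IsIso ζ) (x : X.Points) (i : ℤ) :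
    (ζ x).1 i = (ζ (X.shiftBy i x)).1 0 := by simp [h.shiftBy]

instance (X : QuasigroupSFT.{u}) : CompactSpace X.Points :=
  isCompact_iff_compactSpace.1 X.shift.isClosed.isCompact

/-- A bijective 1-block homomorphism gives an isomorphism. -/
theorem isomorphic_of_symbolMap (φ : X.Alph → Y.Alph)
    (hop : ∀ a b, φ (X.op a b) = Y.op (φ a) (φ b))
    (hmem : ∀ x ∈ X.shift.carrier, (fun i => φ (x i)) ∈ Y.shift.carrier)
    (hinj : ∀ x x' : X.Points, (∀ i, φ (x.1 i) = φ (x'.1 i)) → x = x')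
    (hsurj : ∀ y ∈ Y.shift.carrier, ∃ x ∈ X.shift.carrier, ∀ i, φ (x i) = y i) :
    X.Isomorphic Y := by
  let f : X.Points → Y.Points := fun x => ⟨fun i => φ (x.1 i), hmem x.1 x.2⟩
  have hf : Function.Bijective f := by
    constructor
    · intro x x' h
      exact hinj x x' fun i => congrFun (congrArg Subtype.val h) i
    · intro y
      obtain ⟨x, hx, h⟩ := hsurj y.1 y.2
      exact ⟨⟨x, hx⟩, Points.ext h⟩
  have hcont : Continuous f := by
    refine Continuous.subtype_mk (continuous_pi fun i => ?_) _
    exact continuous_of_discreteTopology.comp (continuous_eval X i)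
  exact ⟨Continuous.homeoOfEquivCompactToT2 (f := Equiv.ofBijective f hf) hcont,
    fun x => rfl, fun x y => Points.ext fun i => hop _ _⟩

theorem Isomorphic.symm (h : X.Isomorphic Y) : Y.Isomorphic X :=
  let ⟨ζ, hζ⟩ := h
  ⟨ζ.symm, IsIso.symm hζ⟩

theorem Isomorphic.trans (h : X.Isomorphic Y) (h' : Y.Isomorphic Z) : X.Isomorphic Z :=
  let ⟨ζ, hζ⟩ := h
  let ⟨η, hη⟩ := h'
  ⟨ζ.trans η, IsIso.trans hζ hη⟩

/-- Equality at the coordinate `0` is preserved: the map is a 1-block code. -/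
def IsOneBlock (ζ : X.Points ≃ₜ Y.Points) : Prop :=
  ∀ x x', x.1 0 = x'.1 0 → (ζ x).1 0 = (ζ x').1 0

theorem IsOneBlock.exists_symbolMap {ζ : X.Points ≃ₜ Y.Points} (h : IsOneBlock ζ)
    (hζ : IsIso ζ) : ∃ φ : X.Alph → Y.Alph, (∀ x i, (ζ x).1 i = φ (x.1 i)) ∧
      ∀ a b, φ (X.op a b) = Y.op (φ a) (φ b) := by
  choose p hp using fun a => X.used_at a 0
  have key : ∀ x i, (ζ x).1 i = (ζ (p (x.1 i))).1 0 := by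
    intro x i
    rw [hζ.apply_eq x i]
    exact h _ _ (by simp [hp])
  refine ⟨fun a => (ζ (p a)).1 0, key, fun a b => ?_⟩
  have := key (X.mul (p a) (p b)) 0
  rw [hζ.2, mul_apply, mul_apply, hp, hp] at this
  exact this.symm

/-- A continuous function to a discrete space depends on a finite window. -/
theorem exists_window (X : QuasigroupSFT.{u}) {B : Type u} [TopologicalSpace B]
    [DiscreteTopology B] (f : X.Points → B) (hf : Continuous f) :
    ∃ k : ℕ, ∀ x x' : X.Points,
      (∀ j : ℤ, -(k : ℤ) ≤ j → j ≤ k → x.1 j = x'.1 j) → f x = f x' := by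
  by_contra! hcon
  -- Pairs that agree on `[-k, k]` but have different values form decreasing nonempty compact sets;
  -- a common element would be a pair of equal points.
  let D : ℕ → Set (X.Points × X.Points) := fun k =>
    {p | (∀ j : ℤ, -(k : ℤ) ≤ j → j ≤ k → p.1.1 j = p.2.1 j)} ∩ {p | f p.1 ≠ f p.2}
  have hclosed : ∀ k, IsClosed (D k) := by
    intro k
    refine IsClosed.inter ?_ ?_
    · simp only [Set.ofPred_forall]
      refine isClosed_iInter fun j => isClosed_iInter fun _ => isClosed_iInter fun _ => ?_
      exact isClosed_eq ((continuous_eval X j).comp continuous_fst)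
        ((continuous_eval X j).comp continuous_snd)
    · have : {p : X.Points × X.Points | f p.1 ≠ f p.2} =
          (fun p : X.Points × X.Points => (f p.1, f p.2)) ⁻¹' {q | q.1 ≠ q.2} := rfl
      rw [this]
      exact (isClosed_discrete _).preimage (by fun_prop)
  have hanti : Directed (· ⊇ ·) D := by
    refine Antitone.directed_ge fun m n hmn => ?_
    rintro p ⟨hp, hp'⟩
    exact ⟨fun j hj hj' => hp j (by omega) (by omega), hp'⟩
  obtain ⟨p, hp⟩ := IsCompact.nonempty_iInter_of_directed_nonempty_isCompact_isClosed D hanti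
    (fun k => by
      obtain ⟨x, x', h⟩ := hcon k
      exact ⟨(x, x'), h⟩) (fun k => (hclosed k).isCompact) hclosed
  rw [Set.mem_iInter] at hp
  refine (hp 0).2 (congrArg f (Points.ext fun j => ?_))
  exact (hp j.natAbs).1 j (by omega) (by omega)

theorem exists_coding_window (ζ : X.Points ≃ₜ Y.Points) :
    ∃ k : ℕ, ∀ x x' : X.Points,
      (∀ j : ℤ, -(k : ℤ) ≤ j → j ≤ k → x.1 j = x'.1 j) → (ζ x).1 0 = (ζ x').1 0 :=
  X.exists_window (fun x => (ζ x).1 0)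
    ((continuous_eval Y 0).comp ζ.continuous)

end Isomorphisms

/-! ### Recoding by an injective block map -/

/-- The image of a shift under an injective block map that is a homomorphism. -/
theorem exists_recoding (X : QuasigroupSFT.{u}) {B : Type u} [Finite B] (m : B → B → B)
    (f : X.Points → B) (hlocal : ∀ x x', x.1 0 = x'.1 0 → x.1 1 = x'.1 1 → f x = f x')
    (hmul : ∀ x y, f (X.mul x y) = m (f x) (f y))
    (hinj : ∀ x x', f x = f x' → x.1 0 = x'.1 0) (hsurj : Function.Surjective f) :
    ∃ (W : QuasigroupSFT.{u}) (e : W.Alph ≃ B) (η : X.Points ≃ₜ W.Points), IsIso η ∧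
      (∀ x i, e ((η x).1 i) = f (X.shiftBy i x)) ∧ ∀ b c, e (W.op b c) = m (e b) (e c) := by
  let : TopologicalSpace B := ⊥
  have : DiscreteTopology B := ⟨rfl⟩
  let F : X.Points → ℤ → B := fun x i => f (X.shiftBy i x)
  have hfcont : Continuous f := by
    have : ∀ x : X.Points, ∀ᶠ x' in nhds x, f x' = f x := by
      intro x
      have h0 : ∀ i : ℤ, ∀ᶠ x' : X.Points in nhds x, x'.1 i = x.1 i := fun i => by
        exact (continuous_eval X i).continuousAt.eventually
          (IsOpen.mem_nhds (isOpen_discrete {x.1 i}) rfl)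
      filter_upwards [h0 0, h0 1] with x' h h'
      exact hlocal _ _ h h'
    exact (IsLocallyConstant.iff_eventually_eq f).2 this |>.continuous
  have hshiftcont : ∀ i, Continuous (X.shiftBy i) := fun i =>
    Continuous.subtype_mk (continuous_pi fun j => continuous_eval X (i + j)) _
  have hFcont : Continuous F := continuous_pi fun i => hfcont.comp (hshiftcont i)
  have hFinj : Function.Injective F := fun x x' h => Points.ext fun i => by
    simpa using hinj _ _ (congrFun h i)
  have hFmul : ∀ x y, F (X.mul x y) = fun i => m (F x i) (F y i) := fun x y =>
    funext fun i => hmul (X.shiftBy i x) (X.shiftBy i y)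
  have hused : ∀ b : B, ∃ y ∈ Set.range F, y 0 = b := by
    intro b
    obtain ⟨x, rfl⟩ := hsurj b
    refine ⟨_, ⟨x, rfl⟩, hlocal _ _ (by simp) (by simp)⟩
  have hop : ∀ y ∈ Set.range F, ∀ z ∈ Set.range F, (fun i => m (y i) (z i)) ∈ Set.range F := by
    rintro _ ⟨x, rfl⟩ _ ⟨y, rfl⟩
    exact ⟨X.mul x y, hFmul x y⟩
  have hleft : ∀ x ∈ Set.range F, ∀ y ∈ Set.range F, ∀ z ∈ Set.range F,
      (fun i => m (x i) (y i)) = (fun i => m (x i) (z i)) → y = z := by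
    rintro _ ⟨x, rfl⟩ _ ⟨y, rfl⟩ _ ⟨z, rfl⟩ h
    rw [← hFmul, ← hFmul] at h
    exact congrArg F (Subtype.ext
      (X.left_cancel _ x.2 _ y.2 _ z.2 (congrArg Subtype.val (hFinj h))))
  have hright : ∀ x ∈ Set.range F, ∀ y ∈ Set.range F, ∀ z ∈ Set.range F,
      (fun i => m (y i) (x i)) = (fun i => m (z i) (x i)) → y = z := by
    rintro _ ⟨x, rfl⟩ _ ⟨y, rfl⟩ _ ⟨z, rfl⟩ h
    rw [← hFmul, ← hFmul] at h
    exact congrArg F (Subtype.ext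
      (X.right_cancel _ x.2 _ y.2 _ z.2 (congrArg Subtype.val (hFinj h))))
  have hFshift : ∀ k x, F (X.shiftBy k x) = SymbolicDynamics.FullShift.shift k (F x) :=
    fun k x => funext fun i => congrArg f (Points.ext fun j => by simp [add_assoc])
  let W : QuasigroupSFT.{u} :=
    { Alph := B
      shift := ⟨Set.range F, (isCompact_range hFcont).isClosed, by
        rintro k _ ⟨x, rfl⟩
        exact ⟨X.shiftBy k x, hFshift k x⟩⟩
      nonempty := let ⟨x, hx⟩ := X.nonempty; ⟨_, ⟨⟨x, hx⟩, rfl⟩⟩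
      used := fun b => let ⟨y, hy, h⟩ := hused b; ⟨y, hy, 0, h⟩
      isSFT := isSFT_of_cancellable hused hop hleft hright
      op := m
      op_mem := hop
      left_cancel := hleft
      right_cancel := hright }
  let G : X.Points → W.Points := fun x => ⟨F x, x, rfl⟩
  have hG : Function.Bijective G := by
    constructor
    · intro x x' h
      exact hFinj (congrArg Subtype.val h)
    · rintro ⟨_, x, rfl⟩
      exact ⟨x, rfl⟩
  have hGcont : Continuous G := hFcont.subtype_mk _
  exact ⟨W, Equiv.refl B, Continuous.homeoOfEquivCompactToT2 (f := Equiv.ofBijective G hG) hGcont,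
    ⟨fun x => Subtype.ext (hFshift 1 x), fun x y => Subtype.ext (hFmul x y)⟩,
    fun _ _ => rfl, fun _ _ => rfl⟩

/-! ### Time reversal, exchanging successors and predecessors -/

section Reversal

/-- The shift with reversed time. -/
abbrev rev (X : QuasigroupSFT.{u}) : QuasigroupSFT.{u} where
  Alph := X.Alph
  shift := ⟨{x | (fun i => x (-i)) ∈ X.shift.carrier},
    X.shift.isClosed.preimage (continuous_pi fun i => continuous_apply (-i)), fun k x hx => by
      have := X.shift.mapsTo (-k) hx
      have h : (fun i => SymbolicDynamics.FullShift.shift k x (-i)) =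
          SymbolicDynamics.FullShift.shift (-k) fun i => x (-i) := funext fun i => by
        simp [add_comm]
      rw [← h] at this
      exact this⟩
  nonempty := let ⟨x, hx⟩ := X.nonempty; ⟨fun i => x (-i), by simpa using hx⟩
  used := fun a => let ⟨x, hx, h⟩ := X.used_zero a;
    ⟨fun i => x (-i), by simpa using hx, 0, by simpa⟩
  -- The definition of finite type is one-sided in time, so it is derived afresh from cancellation.
  isSFT := isSFT_of_cancellable (op := X.op)
    (fun a => let ⟨x, hx, h⟩ := X.used_zero a; ⟨fun i => x (-i), by simpa using hx, by simpa⟩)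
    (fun x hx y hy => X.op_mem _ hx _ hy)
    (fun x hx y hy z hz h => by
      have := X.left_cancel _ hx _ hy _ hz (funext fun i => congrFun h (-i))
      exact funext fun i => by simpa using congrFun this (-i))
    (fun x hx y hy z hz h => by
      have := X.right_cancel _ hx _ hy _ hz (funext fun i => congrFun h (-i))
      exact funext fun i => by simpa using congrFun this (-i))
  op := X.op
  op_mem := fun x hx y hy => X.op_mem _ hx _ hy
  left_cancel := fun x hx y hy z hz h => by
    have := X.left_cancel _ hx _ hy _ hz (funext fun i => congrFun h (-i))
    exact funext fun i => by simpa using congrFun this (-i)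
  right_cancel := fun x hx y hy z hz h => by
    have := X.right_cancel _ hx _ hy _ hz (funext fun i => congrFun h (-i))
    exact funext fun i => by simpa using congrFun this (-i)

variable {X Y : QuasigroupSFT.{u}}

theorem mem_rev {x : ℤ → X.Alph} :
    x ∈ X.rev.shift.carrier ↔ (fun i => x (-i)) ∈ X.shift.carrier := Iff.rfl

/-- An equality of structures, so that results for reversed shifts can be rewritten back. -/
theorem rev_rev (X : QuasigroupSFT.{u}) : X.rev.rev = X := by
  obtain ⟨A, ⟨S, h₁, h₂⟩, h₃, h₄, h₅, op, h₆, h₇, h₈⟩ := X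
  have h : {x : ℤ → A | (fun i => x (-i)) ∈ {x : ℤ → A | (fun i => x (-i)) ∈ S}} = S :=
    Set.ext fun x => by simp
  simp only [rev]
  congr

theorem rev_foll (X : QuasigroupSFT.{u}) (a : X.Alph) : X.rev.foll a = X.pred a := by
  ext b
  constructor
  · rintro ⟨x, hx, i, rfl, rfl⟩
    exact ⟨_, hx, -(i + 1), by simp, by simp⟩
  · rintro ⟨x, hx, i, rfl, rfl⟩
    exact ⟨fun i => x (-i), by simpa [mem_rev] using hx, -(i + 1), by simp, by simp⟩

theorem rev_pred (X : QuasigroupSFT.{u}) (a : X.Alph) : X.rev.pred a = X.foll a := by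
  ext b
  change a ∈ X.rev.foll b ↔ _
  rw [rev_foll]
  rfl

theorem IsMarkov.rev (h : X.IsMarkov) : X.rev.IsMarkov := by
  obtain ⟨T, hT⟩ := h
  refine ⟨fun a b => T b a, Set.ext fun x => ?_⟩
  rw [mem_rev, hT]
  constructor
  · intro h i
    simpa using h (-(i + 1))
  · intro h i
    simpa using h (-(i + 1))

theorem SplitByPred.rev (h : X.SplitByPred Y) : X.rev.SplitByFoll Y.rev := by
  obtain ⟨a, H, hHa, hH, e, he, hm⟩ := h
  have hp : ∀ p : X.Alph × Set X.Alph, p.2 ∈ X.cosets H ∧ p.2 ⊆ X.pred p.1 ↔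
      p.2 ∈ X.rev.cosets H ∧ p.2 ⊆ X.rev.foll p.1 := fun p => by rw [rev_foll]; rfl
  refine ⟨a, H, by rwa [rev_foll], hH, e.trans (Equiv.subtypeEquivRight hp), fun y => ?_, hm⟩
  rw [mem_rev, he]
  refine and_congr ⟨fun h i => ?_, fun h i => ?_⟩ Iff.rfl
  · simpa using h (-(i + 1))
  · simpa using h (-(i + 1))

theorem SplitByFoll.rev (h : X.SplitByFoll Y) : X.rev.SplitByPred Y.rev := by
  obtain ⟨a, H, hHa, hH, e, he, hm⟩ := h
  have hp : ∀ p : X.Alph × Set X.Alph, p.2 ∈ X.cosets H ∧ p.2 ⊆ X.foll p.1 ↔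
      p.2 ∈ X.rev.cosets H ∧ p.2 ⊆ X.rev.pred p.1 := fun p => by rw [rev_pred]; rfl
  refine ⟨a, H, by rwa [rev_pred], hH, e.trans (Equiv.subtypeEquivRight hp), fun y => ?_, hm⟩
  rw [mem_rev, he]
  refine and_congr ⟨fun h i => ?_, fun h i => ?_⟩ Iff.rfl
  · simpa using h (-(i + 1))
  · simpa using h (-(i + 1))

theorem amalg_points_rev {H : Set X.Alph} {y : ℤ → X.cosets H} :
    (∃ x ∈ X.shift.carrier, ∀ i, x i ∈ (y (-i)).1) ↔
      ∃ x ∈ X.rev.shift.carrier, ∀ i, x i ∈ (y i).1 := by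
  constructor
  · rintro ⟨x, hx, h⟩
    exact ⟨fun i => x (-i), by simpa [mem_rev] using hx, fun i => by simpa using h (-i)⟩
  · rintro ⟨x, hx, h⟩
    exact ⟨_, hx, fun i => h _⟩

theorem AmalgDisjointFoll.rev (h : X.AmalgDisjointFoll Y) : X.rev.AmalgDisjointPred Y.rev := by
  obtain ⟨a, H, hHa, hH, hs, e, he, hm⟩ := h
  refine ⟨a, H, by rwa [rev_pred], hH, fun b => by rw [rev_foll]; exact hs b, e, fun y => ?_, hm⟩
  rw [mem_rev, he]
  refine and_congr ⟨fun h i => ?_, fun h i => ?_⟩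
    (amalg_points_rev (y := fun i => e (y i)))
  · have h := h (-(i + 1))
    simp only [neg_neg, show -(i + 1) + 1 = -i by ring] at h
    obtain ⟨g, hg, hg'⟩ := h
    exact ⟨g, hg, by rw [rev_pred]; exact hg'⟩
  · have h := h (-(i + 1))
    simp only [show -(i + 1) + 1 = -i by ring] at h
    obtain ⟨g, hg, hg'⟩ := h
    exact ⟨g, hg, by rw [rev_pred] at hg'; exact hg'⟩

theorem AmalgDisjointPred.rev (h : X.AmalgDisjointPred Y) : X.rev.AmalgDisjointFoll Y.rev := by
  obtain ⟨a, H, hHa, hH, hs, e, he, hm⟩ := h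
  refine ⟨a, H, by rwa [rev_foll], hH, fun b => by rw [rev_pred]; exact hs b, e, fun y => ?_, hm⟩
  rw [mem_rev, he]
  refine and_congr ⟨fun h i => ?_, fun h i => ?_⟩
    (amalg_points_rev (y := fun i => e (y i)))
  · have h := h (-(i + 1))
    simp only [neg_neg, show -(i + 1) + 1 = -i by ring] at h
    obtain ⟨g, hg, hg'⟩ := h
    exact ⟨g, hg, by rw [rev_foll]; exact hg'⟩
  · have h := h (-(i + 1))
    simp only [show -(i + 1) + 1 = -i by ring] at h
    obtain ⟨g, hg, hg'⟩ := h
    exact ⟨g, hg, by rw [rev_foll] at hg'; exact hg'⟩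

/-- Reversal of the points of a shift. -/
def revPoints (X : QuasigroupSFT.{u}) : X.Points ≃ₜ X.rev.Points where
  toFun x := ⟨fun i => x.1 (-i), by simp⟩
  invFun x := ⟨fun i => x.1 (-i), x.2⟩
  left_inv x := Subtype.ext (funext fun i => by simp)
  right_inv x := Subtype.ext (funext fun i => by simp)
  continuous_toFun := Continuous.subtype_mk (continuous_pi fun i => continuous_eval X (-i)) _
  continuous_invFun := Continuous.subtype_mk (continuous_pi fun i => continuous_eval X.rev (-i)) _

@[simp] theorem revPoints_apply (x : X.Points) (i : ℤ) : (X.revPoints x).1 i = x.1 (-i) := rfl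

@[simp] theorem revPoints_symm_apply (x : X.rev.Points) (i : ℤ) :
    (X.revPoints.symm x).1 i = x.1 (-i) := rfl

/-- The homeomorphism between the reversed shifts. -/
def revHomeo (ζ : X.Points ≃ₜ Y.Points) : X.rev.Points ≃ₜ Y.rev.Points :=
  (X.revPoints.symm.trans ζ).trans Y.revPoints

theorem revHomeo_apply (ζ : X.Points ≃ₜ Y.Points) (x : X.rev.Points) (i : ℤ) :
    (revHomeo ζ x).1 i = (ζ (X.revPoints.symm x)).1 (-i) := rfl

theorem IsIso.rev {ζ : X.Points ≃ₜ Y.Points} (h : IsIso ζ) : IsIso (revHomeo ζ) := by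
  constructor
  · intro x
    have : X.revPoints.symm (X.rev.sigma x) = X.shiftBy (-1) (X.revPoints.symm x) :=
      Points.ext fun i => by
        simp only [revPoints_symm_apply, sigma_apply, shiftBy_apply]
        ring_nf
    refine Points.ext fun i => ?_
    rw [sigma_apply, revHomeo_apply, revHomeo_apply, this, h.shiftBy, shiftBy_apply]
    ring_nf
  · intro x y
    have : X.revPoints.symm (X.rev.mul x y) =
        X.mul (X.revPoints.symm x) (X.revPoints.symm y) := rfl
    refine Points.ext fun i => ?_
    rw [mul_apply, revHomeo_apply, revHomeo_apply, revHomeo_apply, this, h.2]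
    rfl

theorem IsOneBlock.rev {ζ : X.Points ≃ₜ Y.Points} (h : IsOneBlock ζ) : IsOneBlock (revHomeo ζ) :=
  fun x x' hx => h _ _ (by simpa using hx)

theorem Isomorphic.of_rev (h : X.rev.Isomorphic Y.rev) : X.Isomorphic Y := by
  obtain ⟨ζ, hζ⟩ := h
  have := IsIso.rev hζ
  rw [← rev_rev X, ← rev_rev Y]
  exact ⟨_, this⟩

end Reversal

/-! ### Elementary isomorphisms are isomorphisms; undoing splittings -/

section ElementaryIsomorphisms

variable {X Y : QuasigroupSFT.{u}}

theorem SplitByFoll.isomorphic (h : X.SplitByFoll Y) : Y.Isomorphic X := by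
  obtain ⟨a, H, hHa, hH, e, he, hm⟩ := h
  refine isomorphic_of_symbolMap (fun b => (e b).1.1) (fun b c => (hm b c).1)
    (fun y hy => ((he y).1 hy).2) (fun y y' hyy => ?_) (fun x hx => ?_)
  · refine Points.ext fun i => e.injective (Subtype.ext (Prod.ext (hyy i) ?_))
    have h1 := ((he y.1).1 y.2).1 i
    have h2 := ((he y'.1).1 y'.2).1 i
    simp only [← hyy] at h2
    rw [← hH.coset_eq (e (y.1 i)).2.1 h1, ← hH.coset_eq (e (y'.1 i)).2.1 h2]
  · have hfoll : ∀ i, x (i + 1) ∈ X.foll (x i) := fun i => ⟨x, hx, i, rfl, rfl⟩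
    let z : ℤ → X.SplitFollAlph H := fun i =>
      ⟨(x i, hH.coset (x (i + 1))), hH.coset_mem _, hH.coset_subset_foll hHa (hfoll i)⟩
    refine ⟨fun i => e.symm (z i), (he _).2 ?_, fun i => by simp [z]⟩
    simp only [Equiv.apply_symm_apply]
    exact ⟨fun i => hH.mem_coset _, hx⟩

theorem AmalgDisjointFoll.isomorphic (h : X.AmalgDisjointFoll Y) : X.Isomorphic Y := by
  obtain ⟨a, H, hHa, hH, hs, e, he, hm⟩ := h
  have hmem : ∀ x ∈ X.shift.carrier, (fun i => (⟨hH.coset (x i), hH.coset_mem _⟩ : X.cosets H)) ∈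
      X.amalgFollShift H := fun x hx =>
    ⟨fun i => ⟨x i, hH.mem_coset _, hH.coset_subset_foll hHa ⟨x, hx, i, rfl, rfl⟩⟩,
      x, hx, fun i => hH.mem_coset _⟩
  refine isomorphic_of_symbolMap (fun b => e.symm ⟨hH.coset b, hH.coset_mem b⟩) (fun b c => ?_)
    (fun x hx => (he _).2 (by simpa using hmem x hx)) (fun x x' hxx => ?_) (fun y hy => ?_)
  · rw [Equiv.symm_apply_eq]
    refine Subtype.ext ?_
    rw [hm, Equiv.apply_symm_apply, Equiv.apply_symm_apply]
    exact hH.coset_op b c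
  · have hc : ∀ i, hH.coset (x.1 i) = hH.coset (x'.1 i) := fun i =>
      congrArg Subtype.val (e.symm.injective (hxx i))
    refine Points.ext fun i => ?_
    have h1 : x.1 (i + 1) ∈ X.foll (x.1 i) := X.succ_mem_foll x i
    have h2 : x.1 (i + 1) ∈ X.foll (x'.1 i) := by
      have := hH.coset_subset_foll hHa (X.succ_mem_foll x' i)
      rw [← hc] at this
      exact this (hH.mem_coset _)
    have h3 := hH.mem_coset (x.1 i)
    have h4 := hH.mem_coset (x'.1 i)
    rw [← hc] at h4
    obtain ⟨q, hq⟩ := hH.coset_mem (x.1 i)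
    rw [← hq] at h3 h4
    obtain ⟨b, hb, hbx⟩ := h3
    obtain ⟨b', hb', hbx'⟩ := h4
    rw [← hbx, ← hbx']
    rw [← hbx] at h1
    rw [← hbx'] at h2
    -- Both `q • b` and `q • b'` precede `x (i + 1)`. Dividing by a transition `q → c` makes `b` and
    -- `b'` precede `c \ x (i + 1)`, so disjointness inside `H` gives `b = b'`.
    obtain ⟨c, hc⟩ := X.foll_nonempty q
    refine congrArg (X.op q) (hs (X.ld c (x.1 (i + 1))) ⟨hb, ?_⟩ ⟨hb', ?_⟩)
    · simpa [mem_pred_iff] using X.ld_mem_foll hc h1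
    · simpa [mem_pred_iff] using X.ld_mem_foll hc h2
  · obtain ⟨-, x, hx, h⟩ := (he y).1 hy
    refine ⟨x, hx, fun i => ?_⟩
    rw [Equiv.symm_apply_eq]
    exact Subtype.ext (hH.coset_eq (e (y i)).2 (h i))

theorem Elementary.isomorphic (h : X.Elementary Y) : X.Isomorphic Y := by
  rcases h with h | h | h | h
  · exact h.isomorphic.symm
  · exact h.rev.isomorphic.of_rev.symm
  · exact h.isomorphic
  · exact h.rev.isomorphic.of_rev

/-- Renaming the symbols is an amalgamation along a set with one element. -/
theorem amalgDisjointFoll_of_renaming {ζ : X.Points ≃ₜ Y.Points} (hζ : IsIso ζ)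
    (h : ∀ x x', x.1 0 = x'.1 0 ↔ (ζ x).1 0 = (ζ x').1 0) : X.AmalgDisjointFoll Y := by
  obtain ⟨φ, hφ, hφop⟩ := IsOneBlock.exists_symbolMap (fun x x' => (h x x').1) hζ
  have hbij : Function.Bijective φ := by
    constructor
    · intro a b hab
      obtain ⟨x, rfl⟩ := X.used_at a 0
      obtain ⟨x', rfl⟩ := X.used_at b 0
      exact (h x x').2 (by rwa [hφ, hφ])
    · intro b
      obtain ⟨y, rfl⟩ := Y.used_at b 0
      exact ⟨(ζ.symm y).1 0, by rw [← hφ, ζ.apply_symm_apply]⟩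
  let e₀ : X.Alph ≃ Y.Alph := Equiv.ofBijective φ hbij
  obtain ⟨x₀, hx₀⟩ := X.nonempty
  obtain ⟨b₀, hb₀⟩ := X.foll_nonempty (x₀ 0)
  have hcos : ∀ C : Set X.Alph, C ∈ X.cosets {b₀} ↔ ∃ b, C = {b} := by
    intro C
    constructor
    · rintro ⟨g, rfl⟩
      exact ⟨X.op g b₀, by simp⟩
    · rintro ⟨b, rfl⟩
      exact ⟨X.rd b b₀, by simp⟩
  have hbot : X.Compatible {b | (⊥ : Setoid X.Alph) b b₀} :=
    compatible_of_congruence ⊥ (by rintro a _ c _ rfl rfl; rfl) (by rintro a _ c _ rfl rfl; rfl) b₀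
  let s : X.Alph → X.cosets {b₀} := fun b => ⟨{b}, (hcos _).2 ⟨b, rfl⟩⟩
  have hs : Function.Bijective s := by
    constructor
    · intro b c hbc
      exact Set.singleton_injective (congrArg Subtype.val hbc)
    · rintro ⟨C, hC⟩
      obtain ⟨b, rfl⟩ := (hcos C).1 hC
      exact ⟨b, rfl⟩
  refine ⟨x₀ 0, {b₀}, by simpa using hb₀, hbot, fun b => Set.subsingleton_singleton.anti
    Set.inter_subset_left, e₀.symm.trans (Equiv.ofBijective s hs), fun y => ?_, fun b c => ?_⟩
  · have hy : y ∈ Y.shift.carrier ↔ (fun i => e₀.symm (y i)) ∈ X.shift.carrier := by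
      constructor
      · intro hy
        have : (fun i => e₀.symm (y i)) = (ζ.symm ⟨y, hy⟩).1 := funext fun i => by
          rw [Equiv.symm_apply_eq]
          change _ = φ _
          rw [← hφ, ζ.apply_symm_apply]
        rw [this]
        exact (ζ.symm ⟨y, hy⟩).2
      · intro hx
        have : y = (ζ ⟨_, hx⟩).1 := funext fun i => by
          rw [hφ]
          exact (e₀.apply_symm_apply (y i)).symm
        rw [this]
        exact (ζ _).2
    rw [hy]
    constructor
    · intro hx
      refine ⟨fun i => ⟨_, rfl, ?_⟩, _, hx, fun i => rfl⟩
      rintro _ rfl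
      exact ⟨_, hx, i, rfl, rfl⟩
    · rintro ⟨-, x, hx, h⟩
      have : x = fun i => e₀.symm (y i) := funext h
      rwa [← this]
  · change {e₀.symm (Y.op b c)} = Set.image2 X.op {e₀.symm b} {e₀.symm c}
    rw [Set.image2_singleton, Set.singleton_eq_singleton_iff, Equiv.symm_apply_eq]
    change _ = φ _
    rw [hφop]
    exact congrArg₂ _ (e₀.apply_symm_apply b).symm (e₀.apply_symm_apply c).symm

theorem SplitByFoll.isMarkov (h : X.SplitByFoll Y) (hX : X.IsMarkov) : Y.IsMarkov := by
  obtain ⟨a, H, hHa, hH, e, he, hm⟩ := h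
  refine ⟨fun b c => (e c).1.1 ∈ (e b).1.2, Set.ext fun y => ?_⟩
  rw [he, mem_splitFollShift_iff hX]
  rfl

theorem SplitByPred.isMarkov (h : X.SplitByPred Y) (hX : X.IsMarkov) : Y.IsMarkov := by
  have := (h.rev.isMarkov hX.rev).rev
  rwa [rev_rev] at this

/-- For Markov shifts, a splitting by successors is undone by an amalgamation. -/
theorem SplitByFoll.amalg (h : X.SplitByFoll Y) (hX : X.IsMarkov) : Y.AmalgDisjointFoll X := by
  obtain ⟨a, H, hHa, hH, e, he, hm⟩ := h
  let p : Y.Alph → X.Alph := fun b => (e b).1.1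
  have hpop : ∀ b c, p (Y.op b c) = X.op (p b) (p c) := fun b c => (hm b c).1
  have hpld : ∀ b c, p (Y.ld b c) = X.ld (p b) (p c) := fun b c => by
    conv_rhs => rw [← Y.op_ld b c, hpop, ld_op]
  have hfoll : ∀ b c, c ∈ Y.foll b ↔ p c ∈ (e b).1.2 := by
    intro b c
    constructor
    · rintro ⟨y, hy, i, rfl, rfl⟩
      exact ((he y).1 hy).1 i
    · intro hbc
      obtain ⟨y, hy⟩ := Y.used_at c 1
      obtain ⟨z, hz⟩ := Y.used_at b 0
      -- The Markov property permits gluing the past of `z` to the future of `y`, so each allowed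
      -- transition occurs in a point.
      have hmem : (fun i : ℤ => if i ≤ 0 then z.1 i else y.1 i) ∈ Y.shift.carrier := by
        rw [he, mem_splitFollShift_iff hX]
        intro i
        rcases lt_trichotomy i 0 with hi | rfl | hi
        · rw [if_pos hi.le, if_pos (by omega)]
          exact ((he z.1).1 z.2).1 i
        · simp only [zero_add, le_refl, if_true]
          rw [if_neg (by omega), hz, hy]
          exact hbc
        · rw [if_neg (by omega), if_neg (by omega)]
          exact ((he y.1).1 y.2).1 i
      refine ⟨_, hmem, 0, by simpa using hz, ?_⟩
      simpa using hy
  have hsurj : ∀ x ∈ X.shift.carrier, ∃ y ∈ Y.shift.carrier, ∀ i, p (y i) = x i := by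
    intro x hx
    let z : ℤ → X.SplitFollAlph H := fun i => ⟨(x i, hH.coset (x (i + 1))), hH.coset_mem _,
      hH.coset_subset_foll hHa ⟨x, hx, i, rfl, rfl⟩⟩
    refine ⟨fun i => e.symm (z i), (he _).2 ?_, fun i => by simp [p, z]⟩
    simp only [Equiv.apply_symm_apply]
    exact ⟨fun i => hH.mem_coset _, hx⟩
  obtain ⟨y₀, hy₀⟩ := Y.nonempty
  have hop : ∀ a b c d, Setoid.ker p a b → Setoid.ker p c d →
      Setoid.ker p (Y.op a c) (Y.op b d) := fun a b c d h h' => by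
    rw [Setoid.ker_def] at *
    rw [hpop, hpop, h, h']
  have hld : ∀ a b c d, Setoid.ker p a b → Setoid.ker p c d →
      Setoid.ker p (Y.ld a c) (Y.ld b d) := fun a b c d h h' => by
    rw [Setoid.ker_def] at *
    rw [hpld, hpld, h, h']
  set K : Set Y.Alph := {b | Setoid.ker p b (y₀ 1)} with hK
  have hcos : ∀ C : Set Y.Alph, C ∈ Y.cosets K ↔ ∃ g, C = {b | p b = g} := by
    intro C
    rw [hK, cosets_eq_classes _ hop hld]
    constructor
    · rintro ⟨b, rfl⟩
      exact ⟨p b, rfl⟩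
    · rintro ⟨g, rfl⟩
      obtain ⟨x, hx, rfl⟩ := X.used_zero g
      obtain ⟨y, hy, hyx⟩ := hsurj x hx
      exact ⟨y 0, by rw [← hyx 0]; rfl⟩
  have hpsurj : Function.Surjective p := fun g => by
    obtain ⟨x, hx, rfl⟩ := X.used_zero g
    obtain ⟨y, hy, hyx⟩ := hsurj x hx
    exact ⟨y 0, hyx 0⟩
  let s : X.Alph → Y.cosets K := fun g => ⟨{b | p b = g}, (hcos _).2 ⟨g, rfl⟩⟩
  have hs : Function.Bijective s := by
    constructor
    · intro g g' hg
      obtain ⟨b, rfl⟩ := hpsurj g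
      have : b ∈ (s g').1 := by rw [← hg]; rfl
      exact this
    · rintro ⟨C, hC⟩
      obtain ⟨g, rfl⟩ := (hcos C).1 hC
      exact ⟨g, rfl⟩
  refine ⟨y₀ 0, K, fun b hb => ?_, compatible_of_congruence _ hop hld _, ?_,
    Equiv.ofBijective s hs, fun x => ?_, fun g g' => ?_⟩
  · rw [hfoll]
    have hb' : p b = p (y₀ 1) := hb
    rw [hb', ← hfoll]
    exact ⟨y₀, hy₀, 0, rfl, rfl⟩
  -- Two symbols with the same first coordinate and a common successor `c` both carry the coset
  -- containing `p c`.
  · rintro c b ⟨hb, hbc⟩ b' ⟨hb', hbc'⟩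
    rw [mem_pred_iff, hfoll] at hbc hbc'
    refine e.injective (Subtype.ext (Prod.ext (hb.trans hb'.symm) ?_))
    rw [← hH.coset_eq (e b).2.1 hbc, ← hH.coset_eq (e b').2.1 hbc']
  · constructor
    · intro hx
      obtain ⟨y, hy, hyx⟩ := hsurj x hx
      refine ⟨fun i => ⟨y i, hyx i, fun c hc => ?_⟩, y, hy, hyx⟩
      rw [hfoll, show p c = x (i + 1) from hc, ← hyx, ← hfoll]
      exact ⟨y, hy, i, rfl, rfl⟩
    · rintro ⟨-, y, hy, hyx⟩
      have : x = fun i => p (y i) := funext fun i => (hyx i).symm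
      rw [this]
      exact ((he y).1 hy).2
  · refine Set.Subset.antisymm ?_ ?_
    · intro b hb
      obtain ⟨c, hc⟩ := hpsurj g
      refine ⟨c, hc, Y.ld c b, ?_, Y.op_ld c b⟩
      change p (Y.ld c b) = g'
      rw [hpld, show p b = X.op g g' from hb, hc, ld_op]
    · rintro _ ⟨c, hc, d, hd, rfl⟩
      change p (Y.op c d) = X.op g g'
      rw [hpop, show p c = g from hc, show p d = g' from hd]

theorem SplitByPred.amalg (h : X.SplitByPred Y) (hX : X.IsMarkov) : Y.AmalgDisjointPred X := by
  have := (h.rev.amalg hX.rev).rev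
  rwa [rev_rev, rev_rev] at this

end ElementaryIsomorphisms

/-! ### Reducing an isomorphism to a renaming by splittings -/

section Splittings

variable {X Y Z : QuasigroupSFT.{u}}

/-- Given a 1-block isomorphism, the symbols can be split by successors according to the image of
the next symbol. -/
theorem exists_splitByFoll (ζ : X.Points ≃ₜ Y.Points) (hζ : IsIso ζ) (h : IsOneBlock ζ) :
    ∃ (W : QuasigroupSFT.{u}) (η : X.Points ≃ₜ W.Points), IsIso η ∧ X.SplitByFoll W ∧
      ∀ x x', (η x).1 0 = (η x').1 0 ↔ x.1 0 = x'.1 0 ∧ (ζ x).1 1 = (ζ x').1 1 := by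
  obtain ⟨φ, hφ, hφop⟩ := h.exists_symbolMap hζ
  have hφld : ∀ b c, φ (X.ld b c) = Y.ld (φ b) (φ c) := fun b c => by
    conv_rhs => rw [← X.op_ld b c, hφop, ld_op]
  -- Recording predecessor sets as well keeps each class inside a follower set.
  let r : Setoid X.Alph := Setoid.ker fun b => (φ b, X.pred b)
  have hr : ∀ {b c}, r b c ↔ φ b = φ c ∧ X.pred b = X.pred c := Prod.mk_inj
  have hop : ∀ a b c d, r a b → r c d → r (X.op a c) (X.op b d) := by
    intro a b c d hab hcd
    rw [hr] at *
    obtain ⟨g, hg⟩ := X.exists_mem_foll a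
    obtain ⟨g', hg'⟩ := X.exists_mem_foll c
    have hgb : b ∈ X.foll g := hab.2.subset hg
    have hgd : d ∈ X.foll g' := hcd.2.subset hg'
    exact ⟨by rw [hφop, hφop, hab.1, hcd.1],
      X.pred_eq_of_mem (X.op_mem_foll hg hg') (X.op_mem_foll hgb hgd)⟩
  have hld : ∀ a b c d, r a b → r c d → r (X.ld a c) (X.ld b d) := by
    intro a b c d hab hcd
    rw [hr] at *
    obtain ⟨g, hg⟩ := X.exists_mem_foll a
    obtain ⟨g', hg'⟩ := X.exists_mem_foll c
    have hgb : b ∈ X.foll g := hab.2.subset hg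
    have hgd : d ∈ X.foll g' := hcd.2.subset hg'
    exact ⟨by rw [hφld, hφld, hab.1, hcd.1],
      X.pred_eq_of_mem (X.ld_mem_foll hg hg') (X.ld_mem_foll hgb hgd)⟩
  obtain ⟨x₀, hx₀⟩ := X.nonempty
  obtain ⟨b₀, hb₀⟩ := X.foll_nonempty (x₀ 0)
  set H : Set X.Alph := {b | r b b₀} with hHdef
  have hH : X.Compatible H := compatible_of_congruence r hop hld b₀
  have hHa : H ⊆ X.foll (x₀ 0) := fun b hb => by
    have : X.pred b = X.pred b₀ := (hr.1 hb).2
    exact X.mem_pred_iff.1 (this ▸ X.mem_pred_iff.2 hb₀)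
  have hcos : ∀ b c, hH.coset b = hH.coset c ↔ r b c := by
    have hcl : ∀ b, hH.coset b = {c | r c b} := fun b =>
      hH.coset_eq (by rw [hHdef, cosets_eq_classes r hop hld]; exact r.mem_classes b) (r.refl b)
    intro b c
    constructor
    · intro hbc
      have := hH.mem_coset b
      rwa [hbc, hcl] at this
    · intro hbc
      rw [hcl, hcl]
      exact Set.ext fun d => ⟨fun h => r.trans h hbc, fun h => r.trans h (r.symm hbc)⟩
  have hsucc : ∀ x : X.Points, x.1 1 ∈ X.foll (x.1 0) := fun x => X.succ_mem_foll x 0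
  let f : X.Points → X.SplitFollAlph H := fun x =>
    ⟨(x.1 0, hH.coset (x.1 1)), hH.coset_mem _, hH.coset_subset_foll hHa (hsucc x)⟩
  let m : X.SplitFollAlph H → X.SplitFollAlph H → X.SplitFollAlph H := fun p q =>
    ⟨(X.op p.1.1 q.1.1, X.setMul p.1.2 q.1.2), hH.2 _ p.2.1 _ q.2.1, by
      rintro _ ⟨b, hb, c, hc, rfl⟩
      exact X.op_mem_foll (p.2.2 hb) (q.2.2 hc)⟩
  have hf : ∀ x x', f x = f x' ↔ x.1 0 = x'.1 0 ∧ hH.coset (x.1 1) = hH.coset (x'.1 1) :=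
    fun x x' => Subtype.ext_iff.trans Prod.ext_iff
  obtain ⟨W, e, η, hη, heη, hm⟩ := X.exists_recoding m f
    (fun x x' h0 h1 => (hf x x').2 ⟨h0, by rw [h1]⟩)
    (fun x y => Subtype.ext (Prod.ext rfl (hH.coset_op _ _)))
    (fun x x' hxx => ((hf x x').1 hxx).1)
    (by
      rintro ⟨⟨g, C⟩, hC, hCg⟩
      obtain ⟨c, hc⟩ := hH.nonempty_of_mem hC
      obtain ⟨x, rfl, rfl⟩ := (X.mem_foll_iff 0).1 (hCg hc)
      exact ⟨x, Subtype.ext (Prod.ext rfl (hH.coset_eq hC hc))⟩)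
  refine ⟨W, η, hη, ⟨x₀ 0, H, hHa, hH, e, fun y => ?_, fun b c => ?_⟩, fun x x' => ?_⟩
  · constructor
    · intro hy
      obtain ⟨x, hx⟩ := η.surjective ⟨y, hy⟩
      have hyx : ∀ i, e (y i) = f (X.shiftBy i x) := fun i => by rw [← heη, hx]
      constructor
      · intro i
        simp only [hyx, f]
        exact (by simp : x.1 (i + 1 + 0) = x.1 (i + 1)) ▸ hH.mem_coset _
      · simp only [hyx, f, shiftBy_apply, add_zero]
        exact x.2
    · rintro ⟨h1, h2⟩
      have : y = (η ⟨_, h2⟩).1 := funext fun i => e.injective (by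
        rw [heη]
        refine Subtype.ext (Prod.ext (by simp [f]) ?_)
        exact (hH.coset_eq (e (y i)).2.1 (h1 i)).symm)
      rw [this]
      exact (η _).2
  · rw [hm]
    exact ⟨rfl, rfl⟩
  · rw [← e.injective.eq_iff, heη, heη, hf]
    simp only [shiftBy_apply, zero_add]
    refine and_congr_right fun h0 => ?_
    rw [hcos, hr, hφ, hφ]
    refine and_iff_left (X.pred_eq_of_mem (hsucc x) ?_)
    rw [h0]
    exact hsucc x'

/-- Given a 1-block isomorphism, the symbols can be split by predecessors according to the image of
the previous symbol. -/
theorem exists_splitByPred (ζ : X.Points ≃ₜ Y.Points) (hζ : IsIso ζ) (h : IsOneBlock ζ) :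
    ∃ (W : QuasigroupSFT.{u}) (η : X.Points ≃ₜ W.Points), IsIso η ∧ X.SplitByPred W ∧
      ∀ x x', (η x).1 0 = (η x').1 0 ↔ x.1 0 = x'.1 0 ∧ (ζ x).1 (-1) = (ζ x').1 (-1) := by
  obtain ⟨V, η, hη, hs, hc⟩ := exists_splitByFoll _ hζ.rev h.rev
  obtain ⟨W, rfl⟩ : ∃ W : QuasigroupSFT.{u}, V = W.rev := ⟨V.rev, (rev_rev V).symm⟩
  have hs' := hs.rev
  rw [rev_rev, rev_rev] at hs'
  refine ⟨W, (X.revPoints.trans η).trans W.revPoints.symm, ?_, hs', fun x x' => ?_⟩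
  · constructor
    · intro x
      have h1 : X.revPoints (X.sigma x) = X.rev.shiftBy (-1) (X.revPoints x) :=
        Points.ext fun i => by
          simp only [revPoints_apply, sigma_apply, shiftBy_apply]
          ring_nf
      refine Points.ext fun i => ?_
      simp only [Homeomorph.trans_apply, h1, hη.shiftBy, revPoints_symm_apply, sigma_apply,
        shiftBy_apply]
      ring_nf
    · intro x y
      have h1 : X.revPoints (X.mul x y) = X.rev.mul (X.revPoints x) (X.revPoints y) := rfl
      refine Points.ext fun i => ?_
      simp only [Homeomorph.trans_apply, h1, hη.2]
      rfl
  · simpa [revHomeo_apply] using hc (X.revPoints x) (X.revPoints x')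

/-- State splitting by successors or by predecessors. -/
def Split (X Y : QuasigroupSFT.{u}) : Prop := X.SplitByFoll Y ∨ X.SplitByPred Y

theorem Split.elementary (h : X.Split Y) : X.Elementary Y :=
  h.elim Or.inl fun h => Or.inr (Or.inl h)

theorem Split.isMarkov (h : X.Split Y) (hX : X.IsMarkov) : Y.IsMarkov :=
  h.elim (fun h => h.isMarkov hX) fun h => h.isMarkov hX

theorem Split.elementary_symm (h : X.Split Y) (hX : X.IsMarkov) : Y.Elementary X :=
  h.elim (fun h => Or.inr (Or.inr (Or.inl (h.amalg hX))))
    fun h => Or.inr (Or.inr (Or.inr (h.amalg hX)))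

/-- Iterated splittings of a shift lead to the shift on its blocks of a given length. -/
theorem exists_split_blocks (X : QuasigroupSFT.{u}) (m n : ℕ) :
    ∃ (Z : QuasigroupSFT.{u}) (η : X.Points ≃ₜ Z.Points), IsIso η ∧
      Relation.ReflTransGen Split X Z ∧
      ∀ x x', (η x).1 0 = (η x').1 0 ↔ ∀ j : ℤ, -(m : ℤ) ≤ j → j ≤ n → x.1 j = x'.1 j := by
  have hid : ∀ V : QuasigroupSFT.{u}, IsOneBlock (Homeomorph.refl V.Points) := fun V x x' h => h
  induction n with
  | zero =>
    induction m with
    | zero =>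
      refine ⟨X, Homeomorph.refl _, IsIso.refl X, .refl, fun x x' => ?_⟩
      constructor
      · intro h j hj hj'
        obtain rfl : j = 0 := by push_cast at *; omega
        exact h
      · intro h
        exact h 0 (by simp) (by simp)
    | succ m ih =>
      obtain ⟨Z, η, hη, hXZ, h⟩ := ih
      -- Splitting along the identity map appends the previous symbol, so blocks grow by one.
      obtain ⟨W, θ, hθ, hs, hc⟩ := exists_splitByPred _ (IsIso.refl Z) (hid Z)
      refine ⟨W, η.trans θ, hη.trans hθ, hXZ.tail (Or.inr hs), fun x x' => ?_⟩
      rw [Homeomorph.trans_apply, Homeomorph.trans_apply, hc, h]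
      change _ ∧ (η x).1 (-1) = (η x').1 (-1) ↔ _
      rw [hη.apply_eq x (-1), hη.apply_eq x' (-1), h]
      simp only [shiftBy_apply]
      constructor
      · rintro ⟨h1, h2⟩ j hj hj'
        by_cases hjm : -(m : ℤ) ≤ j
        · exact h1 j hjm hj'
        · simpa using h2 (j + 1) (by push_cast at *; omega) (by push_cast at *; omega)
      · intro h
        exact ⟨fun j hj hj' => h j (by push_cast at *; omega) hj',
          fun j hj hj' => h _ (by push_cast at *; omega) (by push_cast at *; omega)⟩
  | succ n ih =>
    obtain ⟨Z, η, hη, hXZ, h⟩ := ih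
    obtain ⟨W, θ, hθ, hs, hc⟩ := exists_splitByFoll _ (IsIso.refl Z) (hid Z)
    refine ⟨W, η.trans θ, hη.trans hθ, hXZ.tail (Or.inl hs), fun x x' => ?_⟩
    rw [Homeomorph.trans_apply, Homeomorph.trans_apply, hc, h]
    change _ ∧ (η x).1 1 = (η x').1 1 ↔ _
    rw [hη.apply_eq x 1, hη.apply_eq x' 1, h]
    simp only [shiftBy_apply]
    constructor
    · rintro ⟨h1, h2⟩ j hj hj'
      by_cases hjn : j ≤ n
      · exact h1 j hj hjn
      · simpa using h2 (j - 1) (by push_cast at *; omega) (by push_cast at *; omega)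
    · intro h
      exact ⟨fun j hj hj' => h j hj (by push_cast at *; omega),
        fun j hj hj' => h _ (by push_cast at *; omega) (by push_cast at *; omega)⟩

/-- A 1-block isomorphism becomes a renaming of the symbols after splittings of both shifts. -/
theorem exists_splits_of_window (m n : ℕ) : ∀ {X Y : QuasigroupSFT.{u}}
    (ζ : X.Points ≃ₜ Y.Points), IsIso ζ → IsOneBlock ζ →
    (∀ x x', (∀ j : ℤ, -(m : ℤ) ≤ j → j ≤ n → (ζ x).1 j = (ζ x').1 j) → x.1 0 = x'.1 0) →
    ∃ Z Z' : QuasigroupSFT.{u}, Relation.ReflTransGen Split X Z ∧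
      Relation.ReflTransGen Split Y Z' ∧ Z.AmalgDisjointFoll Z' := by
  have hid : ∀ V : QuasigroupSFT.{u}, IsOneBlock (Homeomorph.refl V.Points) := fun V x x' h => h
  induction n with
  | zero =>
    induction m with
    | zero =>
      intro X Y ζ hζ h1 h2
      refine ⟨X, Y, .refl, .refl, amalgDisjointFoll_of_renaming hζ fun x x' => ⟨h1 x x', fun h =>
        h2 x x' fun j hj hj' => ?_⟩⟩
      obtain rfl : j = 0 := by push_cast at *; omega
      exact h
    | succ m ih =>
      intro X Y ζ hζ h1 h2
      -- With `y = ζ x`, symbols of `V` encode `(x 0, y (-1))` and those of `W` encode `(y 0, y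
      -- (-1))`. The window `[-m, 0]` in `W` then sees `y` on `[-(m + 1), 0]`, enough for both
      -- entries of `V`.
      obtain ⟨V, η, hη, hs, hc⟩ := exists_splitByPred ζ hζ h1
      obtain ⟨W, θ, hθ, hs', hc'⟩ := exists_splitByPred _ (IsIso.refl Y) (hid Y)
      obtain ⟨Z, Z', hZ, hZ', hZZ⟩ := ih ((η.symm.trans ζ).trans θ) ((hη.symm.trans hζ).trans hθ)
        (fun v v' hv => by
          obtain ⟨x, rfl⟩ := η.surjective v
          obtain ⟨x', rfl⟩ := η.surjective v'
          obtain ⟨h3, h4⟩ := (hc x x').1 hv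
          simpa using (hc' (ζ x) (ζ x')).2 ⟨h1 x x' h3, h4⟩)
        (fun v v' hv => by
          obtain ⟨x, rfl⟩ := η.surjective v
          obtain ⟨x', rfl⟩ := η.surjective v'
          have key : ∀ j : ℤ, -((m + 1 : ℕ) : ℤ) ≤ j → j ≤ (0 : ℕ) →
              (ζ x).1 j = (ζ x').1 j := by
            have h3 : ∀ j : ℤ, -(m : ℤ) ≤ j → j ≤ (0 : ℕ) →
                (ζ x).1 j = (ζ x').1 j ∧ (ζ x).1 (j - 1) = (ζ x').1 (j - 1) := by
              intro j hj hj'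
              have h4 := hv j hj hj'
              simp only [Homeomorph.trans_apply, Homeomorph.symm_apply_apply] at h4
              rw [hθ.apply_eq, hθ.apply_eq (ζ x'), hc'] at h4
              simpa [sub_eq_add_neg] using h4
            intro j hj hj'
            by_cases hjm : -(m : ℤ) ≤ j
            · exact (h3 j hjm hj').1
            · simpa using (h3 (j + 1) (by push_cast at *; omega) (by push_cast at *; omega)).2
          exact (hc x x').2 ⟨h2 x x' key, key _ (by push_cast; omega) (by simp)⟩)
      exact ⟨Z, Z', hZ.head (Or.inr hs), hZ'.head (Or.inr hs'), hZZ⟩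
  | succ n ih =>
    intro X Y ζ hζ h1 h2
    obtain ⟨V, η, hη, hs, hc⟩ := exists_splitByFoll ζ hζ h1
    obtain ⟨W, θ, hθ, hs', hc'⟩ := exists_splitByFoll _ (IsIso.refl Y) (hid Y)
    obtain ⟨Z, Z', hZ, hZ', hZZ⟩ := ih ((η.symm.trans ζ).trans θ) ((hη.symm.trans hζ).trans hθ)
      (fun v v' hv => by
        obtain ⟨x, rfl⟩ := η.surjective v
        obtain ⟨x', rfl⟩ := η.surjective v'
        obtain ⟨h3, h4⟩ := (hc x x').1 hv
        simpa using (hc' (ζ x) (ζ x')).2 ⟨h1 x x' h3, h4⟩)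
      (fun v v' hv => by
        obtain ⟨x, rfl⟩ := η.surjective v
        obtain ⟨x', rfl⟩ := η.surjective v'
        have key : ∀ j : ℤ, -(m : ℤ) ≤ j → j ≤ (n + 1 : ℕ) → (ζ x).1 j = (ζ x').1 j := by
          have h3 : ∀ j : ℤ, -(m : ℤ) ≤ j → j ≤ n →
              (ζ x).1 j = (ζ x').1 j ∧ (ζ x).1 (j + 1) = (ζ x').1 (j + 1) := by
            intro j hj hj'
            have h4 := hv j hj hj'
            simp only [Homeomorph.trans_apply, Homeomorph.symm_apply_apply] at h4
            rw [hθ.apply_eq, hθ.apply_eq (ζ x'), hc'] at h4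
            simpa using h4
          intro j hj hj'
          by_cases hjn : j ≤ n
          · exact (h3 j hj hjn).1
          · simpa using (h3 (j - 1) (by push_cast at *; omega) (by push_cast at *; omega)).2
        exact (hc x x').2 ⟨h2 x x' key, key _ (by omega) (by push_cast; omega)⟩)
    exact ⟨Z, Z', hZ.head (Or.inl hs), hZ'.head (Or.inl hs'), hZZ⟩

/-- Isomorphic shifts have iterated splittings that agree up to the names of the symbols. -/
theorem Isomorphic.exists_splits (h : X.Isomorphic Y) : ∃ Z Z' : QuasigroupSFT.{u},
    Relation.ReflTransGen Split X Z ∧ Relation.ReflTransGen Split Y Z' ∧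
      Z.AmalgDisjointFoll Z' := by
  obtain ⟨ζ, hζ⟩ := h
  have hζ : IsIso ζ := hζ
  obtain ⟨k, hk⟩ := exists_coding_window ζ
  obtain ⟨l, hl⟩ := exists_coding_window ζ.symm
  obtain ⟨V, η, hη, hXV, hc⟩ := X.exists_split_blocks k k
  -- A symbol of `V` is a block of `x` on `[-k, k]`, and each of its entries needs `l` further
  -- coordinates of the image on either side.
  obtain ⟨Z, Z', hZ, hZ', hZZ⟩ := exists_splits_of_window (k + l) (k + l) (η.symm.trans ζ)
    (hη.symm.trans hζ)
    (fun v v' hv => by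
      obtain ⟨x, rfl⟩ := η.surjective v
      obtain ⟨x', rfl⟩ := η.surjective v'
      simpa using hk x x' ((hc x x').1 hv))
    (fun v v' hv => by
      obtain ⟨x, rfl⟩ := η.surjective v
      obtain ⟨x', rfl⟩ := η.surjective v'
      refine (hc x x').2 fun j hj hj' => ?_
      have := hl (Y.shiftBy j (ζ x)) (Y.shiftBy j (ζ x')) fun i hi hi' => by
        simpa using hv (j + i) (by push_cast; omega) (by push_cast; omega)
      simpa [hζ.symm.shiftBy] using this)
  exact ⟨Z, Z', hXV.trans hZ, hZ', hZZ⟩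

end Splittings

end QuasigroupSFT

/-! ### The theorem -/

theorem mainTheorem5 (X Y : QuasigroupSFT.{u}) :
    (X.Isomorphic Y ↔
      Relation.ReflTransGen (fun V W => V.Elementary W ∨ W.Elementary V) X Y) ∧
    (X.IsMarkov → Y.IsMarkov →
      (X.Isomorphic Y ↔
        Relation.ReflTransGen (fun V W => V.IsMarkov ∧ W.IsMarkov ∧ V.Elementary W) X Y)) := by
  have hback : ∀ {R : QuasigroupSFT.{u} → QuasigroupSFT.{u} → Prop},
      (∀ V W, R V W → V.Isomorphic W) → Relation.ReflTransGen R X Y → X.Isomorphic Y := by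
    intro R hR h
    induction h with
    | refl => exact ⟨_, QuasigroupSFT.IsIso.refl X⟩
    | tail _ h ih => exact ih.trans (hR _ _ h)
  refine ⟨⟨fun h => ?_, hback fun V W h => h.elim (·.isomorphic) (·.isomorphic.symm)⟩,
    fun hX hY => ⟨fun h => ?_, hback fun V W h => h.2.2.isomorphic⟩⟩
  · obtain ⟨Z, Z', hZ, hZ', hZZ⟩ := h.exists_splits
    refine ((Relation.ReflTransGen.mono
      (fun V W h => Or.inl (QuasigroupSFT.Split.elementary h)) _ _ hZ).tail
      (Or.inl (Or.inr (Or.inr (Or.inl hZZ))))).trans ?_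
    exact Relation.ReflTransGen.mono (fun V W h => Or.inr (QuasigroupSFT.Split.elementary h)) _ _
      (Relation.ReflTransGen.swap _ _ hZ')
  · obtain ⟨Z, Z', hZ, hZ', hZZ⟩ := h.exists_splits
    -- Splittings preserve the Markov property, and a chain of them can be travelled backwards by
    -- amalgamations.
    have hfwd : ∀ {V W : QuasigroupSFT.{u}}, V.IsMarkov →
        Relation.ReflTransGen QuasigroupSFT.Split V W →
        W.IsMarkov ∧
          Relation.ReflTransGen (fun V W => V.IsMarkov ∧ W.IsMarkov ∧ V.Elementary W) V W ∧
          Relation.ReflTransGen (fun V W => V.IsMarkov ∧ W.IsMarkov ∧ V.Elementary W) W V := by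
      intro V W hV h
      induction h with
      | refl => exact ⟨hV, .refl, .refl⟩
      | tail _ h ih =>
        obtain ⟨h1, h2, h3⟩ := ih
        have h4 := h.isMarkov h1
        exact ⟨h4, h2.tail ⟨h1, h4, h.elementary⟩, h3.head ⟨h4, h1, h.elementary_symm h1⟩⟩
    obtain ⟨h1, h2, -⟩ := hfwd hX hZ
    obtain ⟨h3, -, h4⟩ := hfwd hY hZ'
    exact (h2.tail ⟨h1, h3, Or.inr (Or.inr (Or.inl hZZ))⟩).trans h4
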